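/- Let $\Omega=(0,1)$ and let $\|\cdot\|$, $\langle\cdot,\cdot\rangle$ be the norm and scalar product of $L_2(\Omega)$. Let $p\ge 3$ be an integer and let $\lambda\ge 3$, $\sigma\ge p-1$ and $M$ be real numbers. There is a constant $C>0$ depending only on $p,\lambda,\sigma,M$ such that the following holds for every $\varepsilon\in(0,1]$, every positive integer $N$ divisible by $4$, and all real functions $f,u$. Suppose that $u$ is the solution of $$\varepsilon^4u^{(4)}+4u=f\ \text{ in }\Omega,\qquad u=u'=0\ \text{ at } 0 \text{ and } 1,$$ and that $u=u_{\mathrm{bl},0}+u_{\mathrm{reg}}+u_{\mathrm{bl},1}$ on $[0,1]$, where the three components are $p+3$ times differentiable on $[0,1]$, satisfy for $x\in[0,1]$ and $\kappa=0,1,\dots,p+3$ the bounds $$|u_{\mathrm{reg}}^{(\kappa)}(x)|\le M,\qquad |u_{\mathrm{bl},0}^{(\kappa)}(x)|\le M\varepsilon^{-\kappa}e^{-x/\varepsilon},\qquad |u_{\mathrm{bl},1}^{(\kappa)}(x)|\le M\varepsilon^{-\kappa}e^{-(1-x)/\varepsilon},$$ and solve in $\Omega$ the equations $\varepsilon^4u_{\mathrm{reg}}^{(4)}+4u_{\mathrm{reg}}=f$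 and $\varepsilon^4u_{\mathrm{bl},i}^{(4)}+4u_{\mathrm{bl},i}=0$ $(i=0,1)$. Let $\tau=\min\{1/4,\sigma\varepsilon\ln N\}$ and consider the Shishkin mesh on which $[0,\tau]$ and $[1-\tau,1]$ are divided uniformly into $N/4$ intervals each and $[\tau,1-\tau]$ is divided uniformly into $N/2$ intervals. Let $\mathcal S_p^1$ be the space of functions in $C^1[0,1]$ that are polynomials of degree at most $p$ on each mesh interval, and let $V_h=(\mathcal S_p^1\times\mathcal S_p^1)\cap\bigl(H_0^2(\Omega)\times H^2(\Omega)\bigr)$. Put $$\mathcal B\bigl((u,v),(u_*,v_*)\bigr)=\lambda\langle v-\varepsilon^{3/2}u'',v_*-\varepsilon^{3/2}u_*''\rangle+\langle\varepsilon^{5/2}v''+4u,\varepsilon^{3/2}v_*''+4u_*\rangle,\qquad \mathcal F\bigl((u_*,v_*)\bigr)=\langle f,\varepsilon^{3/2}v_*''+4u_*\rangle$$ and let the balanced norm be given by $$|\!|\!|(u,v)|\!|\!|^2=\|u\|^2+\varepsilon^3\|u''\|^2+\|v\|^2+\varepsilon^4\|v''\|^2.$$ Then there is exactly one $(u_h,v_h)\in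 V_h$ with $\mathcal B\bigl((u_h,v_h),(u_*,v_*)\bigr)=\mathcal F\bigl((u_*,v_*)\bigr)$ for all $(u_*,v_*)\in V_h$, and it satisfies $$|\!|\!|(u-u_h,\ \varepsilon^{3/2}u''-v_h)|\!|\!|\le C\,(N^{-1}\ln N)^{p-1}.$$ -/

import Mathlib

open MeasureTheory Set
open scoped ContDiff Polynomial

noncomputable section

namespace ThinShell

/-! ### `L₂(0,1)` and Sobolev spaces on `(0,1)` -/

/-- Lebesgue measure on the domain `Ω = (0,1)`. -/
def domainMeasure : Measure ℝ := volume.restrict (Ioo 0 1)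

/-- The `L₂(0,1)` scalar product. -/
def scal (g h : ℝ → ℝ) : ℝ := ∫ x, g x * h x ∂domainMeasure

/-- The squared `L₂(0,1)` norm. -/
def normSq (g : ℝ → ℝ) : ℝ := scal g g

/-- Test functions: smooth functions with compact support in `(0,1)`. -/
def IsTestFunction (φ : ℝ → ℝ) : Prop :=
  ContDiff ℝ ∞ φ ∧ HasCompactSupport φ ∧ tsupport φ ⊆ Ioo 0 1

/-- `w ∈ L₂(0,1)` is a weak derivative of order `k` of `u` on `(0,1)`. -/
def IsWeakDeriv (k : ℕ) (u w : ℝ → ℝ) : Prop :=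
  MemLp w 2 domainMeasure ∧
    ∀ φ : ℝ → ℝ, IsTestFunction φ → scal u (iteratedDeriv k φ) = (-1) ^ k * scal w φ

/-- `u ∈ H^k(0,1)`. -/
def MemH (k : ℕ) (u : ℝ → ℝ) : Prop :=
  MemLp u 2 domainMeasure ∧ ∀ j ≤ k, ∃ w, IsWeakDeriv j u w

/-- `u ∈ H²₀(0,1)`: `u ∈ H²(0,1)`, and the representative of `u` in `C¹[0,1]` vanishes at the
two endpoints together with its first derivative. -/
def MemH20 (u : ℝ → ℝ) : Prop :=
  MemH 2 u ∧ ∃ g : ℝ → ℝ, ContDiffOn ℝ 1 g (Icc 0 1) ∧ u =ᵐ[domainMeasure] g ∧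
    g 0 = 0 ∧ g 1 = 0 ∧ derivWithin g (Icc 0 1) 0 = 0 ∧ derivWithin g (Icc 0 1) 1 = 0

open Classical in
/-- The weak second derivative of `u` on `(0,1)` (it is unique almost everywhere);
`0` if there is none. -/
def weakD2 (u : ℝ → ℝ) : ℝ → ℝ :=
  if h : ∃ w, IsWeakDeriv 2 u w then h.choose else 0

/-! ### The boundary value problem and the layer decomposition of its solution -/

/-- The `k`-th derivative of `g` on `[0,1]` (one-sided at the endpoints). -/
def D (k : ℕ) (g : ℝ → ℝ) : ℝ → ℝ := iteratedDerivWithin k g (Icc 0 1)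

/-- `g` is `K` times differentiable on `[0,1]`. -/
def TimesDifferentiable (K : ℕ) (g : ℝ → ℝ) : Prop :=
  ∀ k < K, DifferentiableOn ℝ (D k g) (Icc 0 1)

/-- `u` solves `ε⁴ u⁗ + 4 u = f` in `(0,1)` with `u = u' = 0` at `0` and `1`. -/
structure IsSolution (ε : ℝ) (f u : ℝ → ℝ) : Prop where
  diff : TimesDifferentiable 4 u
  ode : ∀ x ∈ Ioo (0 : ℝ) 1, ε ^ 4 * D 4 u x + 4 * u x = f x
  left : u 0 = 0 ∧ D 1 u 0 = 0
  right : u 1 = 0 ∧ D 1 u 1 = 0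

/-- `u = b₀ + r + b₁` on `[0,1]`, with the bounds for the regular component `r` and the layer
components `b₀`, `b₁` and their derivatives up to order `K`, with constant `M`. -/
structure IsLayerDecomposition (ε M : ℝ) (K : ℕ) (f u b₀ r b₁ : ℝ → ℝ) : Prop where
  sum : ∀ x ∈ Icc (0 : ℝ) 1, u x = b₀ x + r x + b₁ x
  diff_reg : TimesDifferentiable K r
  diff_left : TimesDifferentiable K b₀
  diff_right : TimesDifferentiable K b₁
  bound_reg : ∀ k ≤ K, ∀ x ∈ Icc (0 : ℝ) 1, |D k r x| ≤ M
  bound_left : ∀ k ≤ K, ∀ x ∈ Icc (0 : ℝ) 1,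
    |D k b₀ x| ≤ M * (ε ^ k)⁻¹ * Real.exp (-(x / ε))
  bound_right : ∀ k ≤ K, ∀ x ∈ Icc (0 : ℝ) 1,
    |D k b₁ x| ≤ M * (ε ^ k)⁻¹ * Real.exp (-((1 - x) / ε))
  ode_reg : ∀ x ∈ Ioo (0 : ℝ) 1, ε ^ 4 * D 4 r x + 4 * r x = f x
  ode_left : ∀ x ∈ Ioo (0 : ℝ) 1, ε ^ 4 * D 4 b₀ x + 4 * b₀ x = 0
  ode_right : ∀ x ∈ Ioo (0 : ℝ) 1, ε ^ 4 * D 4 b₁ x + 4 * b₁ x = 0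

/-! ### The variational formulation and the balanced norm -/

/-- The bilinear form
`λ ⟨v - ε^{3/2} u'', v⋆ - ε^{3/2} u⋆''⟩ + ⟨ε^{5/2} v'' + 4 u, ε^{3/2} v⋆'' + 4 u⋆⟩`. -/
def bilin (lam ε : ℝ) (u v us vs : ℝ → ℝ) : ℝ :=
  lam * scal (fun x => v x - ε ^ (3 / 2 : ℝ) * weakD2 u x)
      (fun x => vs x - ε ^ (3 / 2 : ℝ) * weakD2 us x) +
    scal (fun x => ε ^ (5 / 2 : ℝ) * weakD2 v x + 4 * u x)
      (fun x => ε ^ (3 / 2 : ℝ) * weakD2 vs x + 4 * us x)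

/-- The linear functional `⟨f, ε^{3/2} v⋆'' + 4 u⋆⟩`. -/
def functional (ε : ℝ) (f us vs : ℝ → ℝ) : ℝ :=
  scal f (fun x => ε ^ (3 / 2 : ℝ) * weakD2 vs x + 4 * us x)

/-- The balanced norm `(‖u‖² + ε³ ‖u''‖² + ‖v‖² + ε⁴ ‖v''‖²)^{1/2}`. -/
def balancedNorm (ε : ℝ) (u v : ℝ → ℝ) : ℝ :=
  √(normSq u + ε ^ 3 * normSq (weakD2 u) + normSq v + ε ^ 4 * normSq (weakD2 v))

/-! ### Splines on Shishkin meshes and the finite element method -/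

/-- The mesh transition point `τ = min {1/4, σ ε ln N}`. -/
def transition (σ ε : ℝ) (N : ℕ) : ℝ := min (1 / 4) (σ * ε * Real.log N)

/-- The nodes `x₀, …, x_N` of the Shishkin mesh (for `N` divisible by `4`): `[0,τ]` and
`[1-τ,1]` are divided uniformly into `N/4` intervals each, `[τ,1-τ]` into `N/2` intervals. -/
def node (σ ε : ℝ) (N i : ℕ) : ℝ :=
  let τ := transition σ ε N
  if 4 * i ≤ N then i * (τ / (N / 4))
  else if 4 * i ≤ 3 * N then τ + (i - N / 4) * ((1 - 2 * τ) / (N / 2))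
  else 1 - τ + (i - 3 * N / 4) * (τ / (N / 4))

/-- The spline space `S_p^k(ω)` on the partition `ω : x 0 < x 1 < ⋯ < x N` of `[0,1]`:
functions in `C^k[0,1]` that are polynomials of degree at most `p` on each mesh interval. -/
def IsSpline (p k N : ℕ) (x : ℕ → ℝ) (s : ℝ → ℝ) : Prop :=
  ContDiffOn ℝ k s (Icc 0 1) ∧
    ∀ i < N, ∃ q : ℝ[X], q.natDegree ≤ p ∧ ∀ t ∈ Ioo (x i) (x (i + 1)), s t = q.eval t

/-- `(u, v)` lies in the finite element space
`V_h = S_p^1(ω)² ∩ (H²₀(0,1) × H²(0,1))` on the Shishkin mesh. -/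
def MemVh (p : ℕ) (σ ε : ℝ) (N : ℕ) (u v : ℝ → ℝ) : Prop :=
  IsSpline p 1 N (node σ ε N) u ∧ IsSpline p 1 N (node σ ε N) v ∧ MemH20 u ∧ MemH 2 v

/-- `(u_h, v_h) ∈ V_h` solves the finite element equations. -/
def IsFEMSolution (p : ℕ) (lam σ ε : ℝ) (N : ℕ) (f uh vh : ℝ → ℝ) : Prop :=
  MemVh p σ ε N uh vh ∧ ∀ us vs : ℝ → ℝ, MemVh p σ ε N us vs →
    bilin lam ε uh vh us vs = functional ε f us vs

end ThinShell

end

/-! Put s = √ε. If u is clamped, two integrations by parts give ⟨v'', u⟩ = ⟨v, u''⟩ with no boundary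
condition on v (`pieceH2.scal_d2_comm`). On the diagonal of the form all mixed terms then collapse
to (4ε + 4 - 2λ) ε^{3/2}⟨v, u''⟩, which for λ ≥ 3 is dominated by (λ - 1)(‖v‖² + ε³‖u''‖²). Hence
the form is coercive in the balanced norm with constant 1 (`balancedSq_le_hilbertForm`). The same
identity gives continuity uniformly in ε (`hilbertForm_le`), since it trades ‖v''‖, on which the
norm puts too small a weight, for ‖u''‖. As (u, ε^{3/2}u'') satisfies the discrete equations
(`bilinMap_exact`), the Galerkin error is at most a constant times the error of any discrete pair
(`sqrt_balancedSq_sub_le`). Coercivity in finite dimension gives existence and uniqueness.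

It remains to approximate u and u'' by C¹ splines. On each cell a Taylor polynomial is corrected by
a cubic that restores the Hermite data at the other end (`exists_interpolant`); equal Hermite data
at the nodes glue the pieces. This handles the regular part, as all cells have length at most 2/N.
For the layer part (`exists_spline_layer`), either the transition point is 1/4 and the uniform mesh
already resolves the layer, or the mesh is fine only near the endpoints. In the second case one
cubic on each layer region cancels the Hermite data at the transition point, so that the spline
continues by zero through the coarse region. There the layer is of size N^{-σ} ≤ N^{-(p-1)}. The
cubic is spread over the whole region, of width τ ≥ ε, so its second derivative costs 1/(τε) and no
inverse mesh width; the powers of ln N that it leaves are absorbed because p ≥ 3.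

Layer errors have L₂ norm of order ε^{1/2}, their second derivatives of order ε^{-3/2}, and for u''
there is a further factor ε^{-2}. The weights of the balanced norm compensate all of these
(`exists_approximation`). -/

noncomputable section

namespace ThinShell

open scoped InnerProductSpace

/-! ### Piecewise twice differentiable functions -/

/-- The derivative on `[0,1]`, one-sided at the endpoints. -/
def d1 (g : ℝ → ℝ) : ℝ → ℝ := derivWithin g (Icc 0 1)

/-- The pointwise second derivative in `(0,1)`. -/
def d2 (g : ℝ → ℝ) : ℝ → ℝ := deriv (d1 g)

lemma uniqueDiffOn_unit : UniqueDiffOn ℝ (Icc (0 : ℝ) 1) := uniqueDiffOn_Icc one_pos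

lemma contDiffOn_one_iff {g : ℝ → ℝ} : ContDiffOn ℝ 1 g (Icc 0 1) ↔
    DifferentiableOn ℝ g (Icc 0 1) ∧ ContinuousOn (d1 g) (Icc 0 1) :=
  contDiffOn_one_iff_derivWithin uniqueDiffOn_unit

lemma d1_add {f g : ℝ → ℝ} (hf : ContDiffOn ℝ 1 f (Icc 0 1)) (hg : ContDiffOn ℝ 1 g (Icc 0 1))
    {x : ℝ} (hx : x ∈ Icc (0 : ℝ) 1) : d1 (f + g) x = d1 f x + d1 g x :=
  derivWithin_add ((contDiffOn_one_iff.1 hf).1 x hx) ((contDiffOn_one_iff.1 hg).1 x hx)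

lemma d1_smul {f : ℝ → ℝ} (c : ℝ) (hf : ContDiffOn ℝ 1 f (Icc 0 1))
    {x : ℝ} (hx : x ∈ Icc (0 : ℝ) 1) : d1 (c • f) x = c * d1 f x :=
  derivWithin_const_smul c ((contDiffOn_one_iff.1 hf).1 x hx)

lemma hasDerivAt_d1_add {f g : ℝ → ℝ} (hf : ContDiffOn ℝ 1 f (Icc 0 1))
    (hg : ContDiffOn ℝ 1 g (Icc 0 1)) {x : ℝ} (hx : x ∈ Ioo (0 : ℝ) 1)
    (hf' : DifferentiableAt ℝ (d1 f) x) (hg' : DifferentiableAt ℝ (d1 g) x) :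
    HasDerivAt (d1 (f + g)) (d2 f x + d2 g x) x := by
  refine (hf'.hasDerivAt.add hg'.hasDerivAt).congr_of_eventuallyEq ?_
  filter_upwards [Icc_mem_nhds hx.1 hx.2] with y hy
  exact d1_add hf hg hy

lemma hasDerivAt_d1_smul {f : ℝ → ℝ} (c : ℝ) (hf : ContDiffOn ℝ 1 f (Icc 0 1))
    {x : ℝ} (hx : x ∈ Ioo (0 : ℝ) 1) (hf' : DifferentiableAt ℝ (d1 f) x) :
    HasDerivAt (d1 (c • f)) (c * d2 f x) x := by
  refine (hf'.hasDerivAt.const_smul c).congr_of_eventuallyEq ?_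
  filter_upwards [Icc_mem_nhds hx.1 hx.2] with y hy
  exact d1_smul c hf hy

/-- The space of `C¹[0,1]` functions whose second derivative exists and is bounded outside of a
countable set. -/
def pieceH2 : Submodule ℝ (ℝ → ℝ) where
  carrier := {g | ContDiffOn ℝ 1 g (Icc 0 1) ∧ ∃ S : Set ℝ, S.Countable ∧ ∃ B : ℝ,
    ∀ x ∈ Ioo (0 : ℝ) 1 \ S, DifferentiableAt ℝ (d1 g) x ∧ |d2 g x| ≤ B}
  add_mem' := by
    rintro f g ⟨hf, S, hS, B, hB⟩ ⟨hg, S', hS', B', hB'⟩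
    refine ⟨hf.add hg, S ∪ S', hS.union hS', B + B', fun x hx => ?_⟩
    obtain ⟨h1, h2⟩ := hB x ⟨hx.1, fun h => hx.2 (Or.inl h)⟩
    obtain ⟨h3, h4⟩ := hB' x ⟨hx.1, fun h => hx.2 (Or.inr h)⟩
    have h := hasDerivAt_d1_add hf hg hx.1 h1 h3
    refine ⟨h.differentiableAt, ?_⟩
    rw [show d2 (f + g) x = _ from h.deriv]
    exact (abs_add_le _ _).trans (add_le_add h2 h4)
  zero_mem' := by
    refine ⟨contDiffOn_const, ∅, countable_empty, 0, fun x _ => ?_⟩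
    have h : d1 (0 : ℝ → ℝ) = fun _ => 0 := by
      exact derivWithin_const (Icc (0 : ℝ) 1) (0 : ℝ)
    simp [d2, h]
  smul_mem' := by
    rintro c f ⟨hf, S, hS, B, hB⟩
    refine ⟨hf.const_smul c, S, hS, |c| * B, fun x hx => ?_⟩
    obtain ⟨h1, h2⟩ := hB x hx
    have h := hasDerivAt_d1_smul c hf hx.1 h1
    refine ⟨h.differentiableAt, ?_⟩
    rw [show d2 (c • f) x = _ from h.deriv, abs_mul]
    gcongr

instance : IsFiniteMeasure domainMeasure := by
  unfold domainMeasure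
  infer_instance

lemma ae_domain_iff {P : ℝ → Prop} :
    (∀ᵐ x ∂domainMeasure, P x) ↔ ∀ᵐ x, x ∈ Ioo (0 : ℝ) 1 → P x :=
  ae_restrict_iff' measurableSet_Ioo

lemma ae_domain_of_countable {P : ℝ → Prop} {S : Set ℝ} (hS : S.Countable)
    (h : ∀ x ∈ Ioo (0 : ℝ) 1 \ S, P x) : ∀ᵐ x ∂domainMeasure, P x := by
  rw [ae_domain_iff]
  filter_upwards [hS.ae_notMem volume] with x hx hx'
  exact h x ⟨hx', hx⟩

lemma ae_domain_of_forall {P : ℝ → Prop} (h : ∀ x ∈ Ioo (0 : ℝ) 1, P x) :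
    ∀ᵐ x ∂domainMeasure, P x :=
  ae_domain_of_countable countable_empty fun x hx => h x hx.1

lemma integral_domain (f : ℝ → ℝ) : ∫ x, f x ∂domainMeasure = ∫ x in (0 : ℝ)..1, f x := by
  rw [intervalIntegral.integral_of_le zero_le_one, integral_Ioc_eq_integral_Ioo, domainMeasure]

lemma integrable_domain_iff {f : ℝ → ℝ} :
    Integrable f domainMeasure ↔ IntervalIntegrable f volume 0 1 := by
  rw [intervalIntegrable_iff_integrableOn_Ioo_of_le zero_le_one, domainMeasure, IntegrableOn]

/-- The fundamental theorem of calculus survives a countable exceptional set when the primitive is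
continuous; thus jumps of the second derivative of a spline at the nodes do not matter. -/
lemma integral_domain_deriv {F f : ℝ → ℝ} {S : Set ℝ} (hS : S.Countable)
    (hF : ContinuousOn F (Icc 0 1)) (h : ∀ x ∈ Ioo (0 : ℝ) 1 \ S, HasDerivAt F (f x) x)
    (hf : Integrable f domainMeasure) : ∫ x, f x ∂domainMeasure = F 1 - F 0 := by
  rw [integral_domain]
  exact integral_eq_of_hasDerivAt_off_countable_of_le F f zero_le_one hS hF h
    (integrable_domain_iff.1 hf)

lemma memLp_of_continuousOn {g : ℝ → ℝ} (hg : ContinuousOn g (Icc 0 1)) :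
    MemLp g 2 domainMeasure := by
  obtain ⟨B, hB⟩ := isCompact_Icc.exists_bound_of_continuousOn hg
  refine MemLp.of_bound ?_ B (ae_domain_of_forall fun x hx => hB x (Ioo_subset_Icc_self hx))
  exact (hg.mono Ioo_subset_Icc_self).aestronglyMeasurable measurableSet_Ioo

section pieceH2

variable {f g u v : ℝ → ℝ}

lemma pieceH2.continuousOn (hg : g ∈ pieceH2) : ContinuousOn g (Icc 0 1) := hg.1.continuousOn

lemma pieceH2.continuousOn_d1 (hg : g ∈ pieceH2) : ContinuousOn (d1 g) (Icc 0 1) :=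
  (contDiffOn_one_iff.1 hg.1).2

lemma pieceH2.memLp (hg : g ∈ pieceH2) : MemLp g 2 domainMeasure :=
  memLp_of_continuousOn (pieceH2.continuousOn hg)

lemma pieceH2.memLp_d1 (hg : g ∈ pieceH2) : MemLp (d1 g) 2 domainMeasure :=
  memLp_of_continuousOn (pieceH2.continuousOn_d1 hg)

lemma pieceH2.memLp_d2 (hg : g ∈ pieceH2) : MemLp (d2 g) 2 domainMeasure := by
  obtain ⟨-, S, hS, B, hB⟩ := hg
  exact MemLp.of_bound (measurable_deriv _).aestronglyMeasurable B
    (ae_domain_of_countable hS fun x hx => (hB x hx).2)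

lemma pieceH2.hasDerivAt (hg : g ∈ pieceH2) {x : ℝ} (hx : x ∈ Ioo (0 : ℝ) 1) :
    HasDerivAt g (d1 g x) x :=
  ((contDiffOn_one_iff.1 hg.1).1 x (Ioo_subset_Icc_self hx)).hasDerivWithinAt.hasDerivAt
    (Icc_mem_nhds hx.1 hx.2)

lemma pieceH2.d2_add (hf : f ∈ pieceH2) (hg : g ∈ pieceH2) :
    d2 (f + g) =ᵐ[domainMeasure] d2 f + d2 g := by
  obtain ⟨hf, S, hS, B, hB⟩ := hf
  obtain ⟨hg, S', hS', B', hB'⟩ := hg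
  refine ae_domain_of_countable (hS.union hS') fun x hx => ?_
  exact (hasDerivAt_d1_add hf hg hx.1 (hB x ⟨hx.1, fun h => hx.2 (Or.inl h)⟩).1
    (hB' x ⟨hx.1, fun h => hx.2 (Or.inr h)⟩).1).deriv

lemma pieceH2.d2_smul (c : ℝ) (hf : f ∈ pieceH2) :
    d2 (c • f) =ᵐ[domainMeasure] c • d2 f := by
  obtain ⟨hf, S, hS, B, hB⟩ := hf
  exact ae_domain_of_countable hS fun x hx => (hasDerivAt_d1_smul c hf hx.1 (hB x hx).1).deriv

lemma pieceH2.of_hasDerivWithinAt {g1 g2 : ℝ → ℝ} {B : ℝ}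
    (h1 : ∀ x ∈ Icc (0 : ℝ) 1, HasDerivWithinAt g (g1 x) (Icc 0 1) x)
    (h2 : ∀ x ∈ Icc (0 : ℝ) 1, HasDerivWithinAt g1 (g2 x) (Icc 0 1) x)
    (hB : ∀ x ∈ Icc (0 : ℝ) 1, |g2 x| ≤ B) :
    g ∈ pieceH2 ∧ EqOn (d1 g) g1 (Icc 0 1) ∧ EqOn (d2 g) g2 (Ioo 0 1) := by
  have e1 : EqOn (d1 g) g1 (Icc 0 1) := fun x hx => (h1 x hx).derivWithin (uniqueDiffOn_unit x hx)
  have e2 : ∀ x ∈ Ioo (0 : ℝ) 1, HasDerivAt (d1 g) (g2 x) x := by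
    intro x hx
    have hn := Icc_mem_nhds hx.1 hx.2
    refine ((h2 x (Ioo_subset_Icc_self hx)).hasDerivAt hn).congr_of_eventuallyEq ?_
    filter_upwards [hn] with y hy using e1 hy
  refine ⟨⟨contDiffOn_one_iff.2 ⟨fun x hx => (h1 x hx).differentiableWithinAt, ?_⟩, ∅,
    countable_empty, B, fun x hx => ⟨(e2 x hx.1).differentiableAt, ?_⟩⟩, e1,
    fun x hx => (e2 x hx).deriv⟩
  · exact ContinuousOn.congr (fun x hx => (h2 x hx).continuousWithinAt) e1
  · rw [show d2 g x = g2 x from (e2 x hx.1).deriv]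
    exact hB x (Ioo_subset_Icc_self hx.1)

lemma MemLp.integrable_mul' {f g : ℝ → ℝ} (hf : MemLp f 2 domainMeasure)
    (hg : MemLp g 2 domainMeasure) : Integrable (fun x => f x * g x) domainMeasure :=
  hf.integrable_mul hg

/-- Integrating by parts twice. -/
lemma pieceH2.scal_d2_comm (hu : u ∈ pieceH2) (hv : v ∈ pieceH2) (u0 : u 0 = 0) (u1 : u 1 = 0)
    (u0' : d1 u 0 = 0) (u1' : d1 u 1 = 0) : scal (d2 v) u = scal v (d2 u) := by
  have hi1 := MemLp.integrable_mul' (memLp_d2 hv) (memLp hu)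
  have hi2 := MemLp.integrable_mul' (memLp hv) (memLp_d2 hu)
  obtain ⟨S, hS, B, hB⟩ := hu.2
  obtain ⟨S', hS', B', hB'⟩ := hv.2
  -- The products of first derivatives cancel in the derivative of v'u - vu', and its boundary
  -- values vanish because u is clamped.
  have key := integral_domain_deriv (F := fun x => d1 v x * u x - v x * d1 u x)
    (f := fun x => d2 v x * u x - v x * d2 u x) (hS.union hS')
    (((continuousOn_d1 hv).mul (continuousOn hu)).sub
      ((continuousOn hv).mul (continuousOn_d1 hu))) ?_ (hi1.sub hi2)
  · rw [integral_sub hi1 hi2] at key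
    simp only [u0, u1, u0', u1', mul_zero, sub_zero] at key
    exact sub_eq_zero.1 key
  · intro x hx
    have a1 := (hB x ⟨hx.1, fun h => hx.2 (Or.inl h)⟩).1.hasDerivAt
    have a2 := (hB' x ⟨hx.1, fun h => hx.2 (Or.inr h)⟩).1.hasDerivAt
    refine ((a2.mul (hasDerivAt hu hx.1)).sub ((hasDerivAt hv hx.1).mul a1)).congr_deriv ?_
    simp only [d2]
    ring

lemma pieceH2.scal_d1 (hv : v ∈ pieceH2) {φ : ℝ → ℝ} (hu : φ ∈ pieceH2) (u0 : φ 0 = 0)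
    (u1 : φ 1 = 0) : scal v (d1 φ) = - scal (d1 v) φ := by
  have hi1 := MemLp.integrable_mul' (memLp_d1 hv) (memLp hu)
  have hi2 := MemLp.integrable_mul' (memLp hv) (memLp_d1 hu)
  have key := integral_domain_deriv (F := fun x => v x * φ x)
    (f := fun x => d1 v x * φ x + v x * d1 φ x) countable_empty
    ((continuousOn hv).mul (continuousOn hu))
    (fun x hx => (hasDerivAt hv hx.1).mul (hasDerivAt hu hx.1)) (hi1.add hi2)
  rw [integral_add hi1 hi2] at key
  simp only [u0, u1, mul_zero, sub_zero] at key
  unfold scal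
  linarith

end pieceH2

/-! ### Weak derivatives -/

lemma scal_congr {f f' g g' : ℝ → ℝ} (hf : f =ᵐ[domainMeasure] f')
    (hg : g =ᵐ[domainMeasure] g') : scal f g = scal f' g' := by
  refine integral_congr_ae ?_
  filter_upwards [hf, hg] with x h1 h2
  rw [h1, h2]

lemma scal_comm (f g : ℝ → ℝ) : scal f g = scal g f := by
  simp only [scal, mul_comm]

lemma IsTestFunction.eq_zero {φ : ℝ → ℝ} (hφ : IsTestFunction φ) {x : ℝ} (hx : x ∉ Ioo (0 : ℝ) 1) :
    φ x = 0 :=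
  image_eq_zero_of_notMem_tsupport fun h => hx (hφ.2.2 h)

lemma IsTestFunction.deriv {φ : ℝ → ℝ} (hφ : IsTestFunction φ) : IsTestFunction (_root_.deriv φ) :=
  ⟨(contDiff_infty_iff_deriv.1 hφ.1).2, hφ.2.1.deriv, tsupport_deriv_subset.trans hφ.2.2⟩

lemma IsTestFunction.mem_pieceH2 {φ : ℝ → ℝ} (hφ : IsTestFunction φ) :
    φ ∈ pieceH2 ∧ EqOn (d1 φ) (_root_.deriv φ) (Icc 0 1) ∧
      EqOn (d2 φ) (iteratedDeriv 2 φ) (Ioo 0 1) := by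
  have hd : ∀ {ψ : ℝ → ℝ}, IsTestFunction ψ → Differentiable ℝ ψ := fun h =>
    (contDiff_infty_iff_deriv.1 h.1).1
  obtain ⟨B, hB⟩ := isCompact_Icc.exists_bound_of_continuousOn
    (s := Icc (0 : ℝ) 1) hφ.deriv.deriv.1.continuous.continuousOn
  have h := pieceH2.of_hasDerivWithinAt (g := φ) (g1 := _root_.deriv φ)
    (g2 := _root_.deriv (_root_.deriv φ)) (B := B)
    (fun x _ => (hd hφ x).hasDerivAt.hasDerivWithinAt)
    (fun x _ => (hd hφ.deriv x).hasDerivAt.hasDerivWithinAt) hB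
  refine ⟨h.1, h.2.1, ?_⟩
  rw [iteratedDeriv_succ, iteratedDeriv_one]
  exact h.2.2

lemma pieceH2.isWeakDeriv_two {g : ℝ → ℝ} (hg : g ∈ pieceH2) : IsWeakDeriv 2 g (d2 g) := by
  refine ⟨memLp_d2 hg, fun φ hφ => ?_⟩
  obtain ⟨h1, h2, h3⟩ := hφ.mem_pieceH2
  have e0 := h2 (left_mem_Icc.2 zero_le_one)
  have e1 := h2 (right_mem_Icc.2 zero_le_one)
  rw [hφ.deriv.eq_zero (by simp)] at e0 e1
  rw [scal_d2_comm h1 hg (hφ.eq_zero (by simp)) (hφ.eq_zero (by simp)) e0 e1,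
    neg_one_sq, one_mul]
  exact scal_congr Filter.EventuallyEq.rfl (ae_domain_of_forall fun x hx => (h3 hx).symm)

lemma pieceH2.memH_two {g : ℝ → ℝ} (hg : g ∈ pieceH2) : MemH 2 g := by
  refine ⟨memLp hg, fun j hj => ?_⟩
  interval_cases j
  · exact ⟨g, memLp hg, fun φ hφ => by simp⟩
  · refine ⟨d1 g, memLp_d1 hg, fun φ hφ => ?_⟩
    obtain ⟨h1, h2, h3⟩ := hφ.mem_pieceH2
    have h := scal_d1 hg h1 (hφ.eq_zero (by simp)) (hφ.eq_zero (by simp))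
    rw [iteratedDeriv_one, pow_one, neg_one_mul, ← h]
    exact scal_congr Filter.EventuallyEq.rfl
      (ae_domain_of_forall fun x hx => (h2 (Ioo_subset_Icc_self hx)).symm)
  · exact ⟨_, isWeakDeriv_two hg⟩

/-- This is the fundamental lemma of the calculus of variations, applied to the difference of the
two candidates. -/
lemma IsWeakDeriv.ae_eq {k : ℕ} {u w w' : ℝ → ℝ} (h : IsWeakDeriv k u w)
    (h' : IsWeakDeriv k u w') : w =ᵐ[domainMeasure] w' := by
  have hm : MemLp (fun x => w x - w' x) 2 domainMeasure := h.1.sub h'.1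
  have hi : Integrable (fun x => w x - w' x) domainMeasure := hm.integrable (by norm_num)
  have key := isOpen_Ioo.ae_eq_zero_of_integral_contDiff_smul_eq_zero (μ := volume)
    (U := Ioo (0 : ℝ) 1) (f := fun x => w x - w' x)
    (IntegrableOn.locallyIntegrableOn hi) ?_
  · rw [Filter.EventuallyEq, ae_domain_iff]
    filter_upwards [key] with x hx hx'
    exact sub_eq_zero.1 (hx hx')
  · intro φ h1 h2 h3
    have hφ : IsTestFunction φ := ⟨h1, h2, h3⟩
    have hLp : MemLp φ 2 domainMeasure := memLp_of_continuousOn h1.continuous.continuousOn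
    have e1 : scal w φ = scal w' φ := by
      have := (h.2 φ hφ).symm.trans (h'.2 φ hφ)
      exact mul_left_cancel₀ (pow_ne_zero k (by norm_num)) this
    have hz : ∫ x, φ x * (w x - w' x) = ∫ x, φ x * (w x - w' x) ∂domainMeasure := by
      rw [domainMeasure, setIntegral_eq_integral_of_forall_compl_eq_zero]
      intro x hx
      rw [hφ.eq_zero hx, zero_mul]
    simp only [smul_eq_mul]
    rw [hz]
    have e2 : scal w φ - scal w' φ = ∫ x, φ x * (w x - w' x) ∂domainMeasure := by
      unfold scal
      rw [← integral_sub (MemLp.integrable_mul' h.1 hLp) (MemLp.integrable_mul' h'.1 hLp)]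
      refine integral_congr_ae (Filter.Eventually.of_forall fun x => ?_)
      ring
    rw [← e2, e1, sub_self]

/-- `weakD2` is an arbitrary choice among weak derivatives; by uniqueness it may be replaced by the
pointwise second derivative under every integral. -/
lemma pieceH2.weakD2_ae_eq {f g : ℝ → ℝ} (hg : g ∈ pieceH2) (hfg : f =ᵐ[domainMeasure] g) :
    weakD2 f =ᵐ[domainMeasure] d2 g := by
  have hw : IsWeakDeriv 2 f (d2 g) := by
    refine ⟨memLp_d2 hg, fun φ hφ => ?_⟩
    rw [scal_congr hfg Filter.EventuallyEq.rfl]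
    exact (isWeakDeriv_two hg).2 φ hφ
  have hex : ∃ w, IsWeakDeriv 2 f w := ⟨_, hw⟩
  have : weakD2 f = hex.choose := by
    unfold weakD2
    rw [dif_pos hex]
  rw [this]
  exact hex.choose_spec.ae_eq hw

/-! ### The bilinear form in a Hilbert space -/

section Hilbert

variable {H : Type*} [NormedAddCommGroup H] [InnerProductSpace ℝ H]

/-- The bilinear form in terms of the functions `u, v` and their second derivatives; `s = √ε`. -/
def hilbertForm (lam s : ℝ) (A A2 B B2 C C2 D D2 : H) : ℝ :=
  lam * ⟪B - s ^ 3 • A2, D - s ^ 3 • C2⟫_ℝ +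
    ⟪s ^ 5 • B2 + (4 : ℝ) • A, s ^ 3 • D2 + (4 : ℝ) • C⟫_ℝ

/-- The square of the balanced norm. -/
def balancedSq (s : ℝ) (A A2 B B2 : H) : ℝ :=
  ‖A‖ ^ 2 + s ^ 6 * ‖A2‖ ^ 2 + ‖B‖ ^ 2 + s ^ 8 * ‖B2‖ ^ 2

lemma hilbertForm_eq (lam s : ℝ) (A A2 B B2 C C2 D D2 : H) :
    hilbertForm lam s A A2 B B2 C C2 D D2 =
      lam * (⟪B, D⟫_ℝ - s ^ 3 * ⟪B, C2⟫_ℝ - s ^ 3 * ⟪A2, D⟫_ℝ + s ^ 6 * ⟪A2, C2⟫_ℝ) +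
        s ^ 8 * ⟪B2, D2⟫_ℝ + 4 * s ^ 5 * ⟪B2, C⟫_ℝ + 4 * s ^ 3 * ⟪A, D2⟫_ℝ + 16 * ⟪A, C⟫_ℝ := by
  simp only [hilbertForm, inner_sub_left, inner_sub_right, inner_add_left, inner_add_right,
    real_inner_smul_left, real_inner_smul_right]
  ring

lemma balancedSq_nonneg {E : Type*} [NormedAddCommGroup E] (s : ℝ) (A A2 B B2 : E) :
    0 ≤ balancedSq s A A2 B B2 := by
  unfold balancedSq
  positivity

/-- Coercivity of the bilinear form. -/
lemma balancedSq_le_hilbertForm {lam s : ℝ} (hlam : 3 ≤ lam) (hs : 0 ≤ s) (hs1 : s ≤ 1)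
    {A A2 B B2 : H} (h : ⟪B2, A⟫_ℝ = ⟪B, A2⟫_ℝ) :
    balancedSq s A A2 B B2 ≤ hilbertForm lam s A A2 B B2 A A2 B B2 := by
  rw [hilbertForm_eq, real_inner_comm B2 A, h, real_inner_comm B A2, balancedSq]
  simp only [real_inner_self_eq_norm_sq]
  set t := s ^ 3 * ⟪B, A2⟫_ℝ with ht
  have hab : |t| ≤ ‖B‖ * (s ^ 3 * ‖A2‖) := by
    rw [ht, abs_mul, abs_of_nonneg (by positivity : 0 ≤ s ^ 3)]
    have := mul_le_mul_of_nonneg_left (abs_real_inner_le_norm B A2) (by positivity : 0 ≤ s ^ 3)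
    linarith
  have h2 : 2 * |t| ≤ ‖B‖ ^ 2 + s ^ 6 * ‖A2‖ ^ 2 := by
    nlinarith [sq_nonneg (‖B‖ - s ^ 3 * ‖A2‖)]
  have hs2 : s ^ 2 ≤ 1 := by nlinarith
  -- The coefficient of `t` lies between 4 - 2λ and 8 - 2λ; both have modulus at most 2(λ - 1) since
  -- λ ≥ 3.
  have h3 : 0 ≤ (lam - 1) * (2 * |t|) + (4 * s ^ 2 + 4 - 2 * lam) * t := by
    rcases le_total 0 t with h0 | h0
    · rw [abs_of_nonneg h0]
      nlinarith [mul_nonneg h0 (sq_nonneg s)]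
    · rw [abs_of_nonpos h0]
      nlinarith [mul_nonneg (neg_nonneg.2 h0) (sub_nonneg.2 hs2),
        mul_nonneg (neg_nonneg.2 h0) (sub_nonneg.2 hlam)]
  have h4 := mul_le_mul_of_nonneg_left h2 (by linarith : 0 ≤ lam - 1)
  have e : lam * (‖B‖ ^ 2 - t - t + s ^ 6 * ‖A2‖ ^ 2) + s ^ 8 * ‖B2‖ ^ 2 +
      4 * s ^ 5 * ⟪B, A2⟫_ℝ + 4 * s ^ 3 * ⟪B, A2⟫_ℝ + 16 * ‖A‖ ^ 2 =
      lam * (‖B‖ ^ 2 + s ^ 6 * ‖A2‖ ^ 2) + (4 * s ^ 2 + 4 - 2 * lam) * t + s ^ 8 * ‖B2‖ ^ 2 +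
        16 * ‖A‖ ^ 2 := by
    rw [ht]
    ring
  rw [e]
  nlinarith [sq_nonneg ‖A‖]

lemma norms_le_sqrt_balancedSq {E : Type*} [NormedAddCommGroup E] (s : ℝ)
    (A A2 B B2 : E) :
    ‖A‖ ≤ √(balancedSq s A A2 B B2) ∧ s ^ 3 * ‖A2‖ ≤ √(balancedSq s A A2 B B2) ∧
      ‖B‖ ≤ √(balancedSq s A A2 B B2) ∧ s ^ 4 * ‖B2‖ ≤ √(balancedSq s A A2 B B2) := by
  have h2 : 0 ≤ s ^ 6 * ‖A2‖ ^ 2 := by positivity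
  have h4 : 0 ≤ s ^ 8 * ‖B2‖ ^ 2 := by positivity
  refine ⟨?_, ?_, ?_, ?_⟩ <;> refine Real.le_sqrt_of_sq_le ?_ <;> unfold balancedSq <;>
    nlinarith [sq_nonneg ‖A‖, sq_nonneg ‖B‖]

/-- Continuity of the bilinear form. -/
lemma hilbertForm_le {lam s : ℝ} (hlam : 0 ≤ lam) (hs : 0 ≤ s) (hs1 : s ≤ 1)
    {A A2 B B2 C C2 D D2 : H} (h : ⟪D2, A⟫_ℝ = ⟪D, A2⟫_ℝ) :
    hilbertForm lam s A A2 B B2 C C2 D D2 ≤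
      (4 * lam + 25) * (√(balancedSq s A A2 B B2) * √(balancedSq s C C2 D D2)) := by
  -- The norm controls only s⁴‖D2‖, too little for the term 4s³⟨A, D2⟩; `h` turns it into 4s³⟨D,
  -- A2⟩, where s³‖A2‖ is controlled.
  rw [hilbertForm_eq, real_inner_comm D2 A, h]
  obtain ⟨a1, a2, a3, a4⟩ := norms_le_sqrt_balancedSq s A A2 B B2
  obtain ⟨c1, c2, c3, c4⟩ := norms_le_sqrt_balancedSq s C C2 D D2
  set m := √(balancedSq s A A2 B B2)
  set n := √(balancedSq s C C2 D D2)
  have hm : 0 ≤ m := Real.sqrt_nonneg _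
  have hn : 0 ≤ n := Real.sqrt_nonneg _
  have key : ∀ (k : ℝ) (X Y : H) (a c : ℝ), 0 ≤ a → 0 ≤ c → |k| ≤ a * c → a * ‖X‖ ≤ m →
      c * ‖Y‖ ≤ n → k * ⟪X, Y⟫_ℝ ≤ m * n := by
    intro k X Y a c ha hc hk h1 h2
    calc k * ⟪X, Y⟫_ℝ ≤ |k * ⟪X, Y⟫_ℝ| := le_abs_self _
      _ = |k| * |⟪X, Y⟫_ℝ| := abs_mul _ _
      _ ≤ (a * c) * (‖X‖ * ‖Y‖) := by
        gcongr
        exact abs_real_inner_le_norm _ _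
      _ = (a * ‖X‖) * (c * ‖Y‖) := by ring
      _ ≤ m * n := by gcongr
  have p3 : 0 ≤ s ^ 3 := by positivity
  have p4 : 0 ≤ s ^ 4 := by positivity
  have i1 := key 1 B D 1 1 one_pos.le one_pos.le (by norm_num) (by simpa using a3)
    (by simpa using c3)
  have i2 := key (-s ^ 3) B C2 1 (s ^ 3) one_pos.le p3 (by rw [abs_neg, abs_of_nonneg p3, one_mul])
    (by simpa using a3) c2
  have i3 := key (-s ^ 3) A2 D (s ^ 3) 1 p3 one_pos.le (by rw [abs_neg, abs_of_nonneg p3, mul_one])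
    a2 (by simpa using c3)
  have i4 := key (s ^ 6) A2 C2 (s ^ 3) (s ^ 3) p3 p3
    (by rw [abs_of_nonneg (by positivity)]; ring_nf; rfl) a2 c2
  have i5 := key (s ^ 8) B2 D2 (s ^ 4) (s ^ 4) p4 p4
    (by rw [abs_of_nonneg (by positivity)]; ring_nf; rfl) a4 c4
  have i6 := key (s ^ 5) B2 C (s ^ 4) 1 p4 one_pos.le
    (by rw [abs_of_nonneg (by positivity), mul_one]; exact pow_le_pow_of_le_one hs hs1 (by norm_num))
    a4 (by simpa using c1)
  have i7 : s ^ 3 * ⟪D, A2⟫_ℝ ≤ m * n := by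
    rw [real_inner_comm]
    exact key (s ^ 3) A2 D (s ^ 3) 1 p3 one_pos.le (by rw [abs_of_nonneg p3, mul_one])
      a2 (by simpa using c3)
  have i8 := key 1 A C 1 1 one_pos.le one_pos.le (by norm_num) (by simpa using a1)
    (by simpa using c1)
  -- Each product is at most m n. The first group gives 4λ, the remaining terms 1 + 4 + 4 + 16 = 25.
  have j : lam * (⟪B, D⟫_ℝ - s ^ 3 * ⟪B, C2⟫_ℝ - s ^ 3 * ⟪A2, D⟫_ℝ + s ^ 6 * ⟪A2, C2⟫_ℝ) ≤
      lam * (4 * (m * n)) := by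
    refine mul_le_mul_of_nonneg_left ?_ hlam
    linarith
  linarith

lemma balancedSq_sub_le (s : ℝ) (A A2 B B2 C C2 D D2 : H) :
    balancedSq s (A - C) (A2 - C2) (B - D) (B2 - D2) ≤
      2 * balancedSq s A A2 B B2 + 2 * balancedSq s C C2 D D2 := by
  have key : ∀ X Y : H, ‖X - Y‖ ^ 2 ≤ 2 * ‖X‖ ^ 2 + 2 * ‖Y‖ ^ 2 := by
    intro X Y
    nlinarith [parallelogram_law_with_norm ℝ X Y, sq_nonneg ‖X + Y‖]
  have h2 := mul_le_mul_of_nonneg_left (key A2 C2) (by positivity : 0 ≤ s ^ 6)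
  have h4 := mul_le_mul_of_nonneg_left (key B2 D2) (by positivity : 0 ≤ s ^ 8)
  unfold balancedSq
  nlinarith [key A C, key B D]

/-- Quasi-optimality of Galerkin approximations: `(A, B)` is the error of an arbitrary element of
the discrete space, `(C, D)` the difference of the Galerkin solution and that element. -/
lemma sqrt_balancedSq_sub_le {lam s : ℝ} (hlam : 3 ≤ lam) (hs : 0 ≤ s) (hs1 : s ≤ 1)
    {A A2 B B2 C C2 D D2 : H} (h : ⟪D2, A⟫_ℝ = ⟪D, A2⟫_ℝ) (h' : ⟪D2, C⟫_ℝ = ⟪D, C2⟫_ℝ)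
    (horth : hilbertForm lam s C C2 D D2 C C2 D D2 = hilbertForm lam s A A2 B B2 C C2 D D2) :
    √(balancedSq s (A - C) (A2 - C2) (B - D) (B2 - D2)) ≤
      2 * (4 * lam + 26) * √(balancedSq s A A2 B B2) := by
  have h1 := balancedSq_le_hilbertForm hlam hs hs1 h'
  have h2 := hilbertForm_le (by linarith : 0 ≤ lam) hs hs1 (B := B) (B2 := B2) (C := C)
    (C2 := C2) h
  rw [← horth] at h2
  have h3 := h1.trans h2
  have hn2 := Real.sq_sqrt (balancedSq_nonneg s C C2 D D2)
  have hm2 := Real.sq_sqrt (balancedSq_nonneg s A A2 B B2)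
  have h5 := balancedSq_sub_le s A A2 B B2 C C2 D D2
  rw [← hn2] at h3 h5
  rw [← hm2] at h5
  have hm : 0 ≤ √(balancedSq s A A2 B B2) := Real.sqrt_nonneg _
  have hn : 0 ≤ √(balancedSq s C C2 D D2) := Real.sqrt_nonneg _
  rw [hn2] at h3
  rw [← hn2] at h3
  generalize √(balancedSq s A A2 B B2) = m at *
  generalize √(balancedSq s C C2 D D2) = n at *
  -- Coercivity, orthogonality and continuity give n² ≤ (4λ + 25) m n; divide by n.
  have h4 : n ≤ (4 * lam + 25) * m := by
    rcases hn.eq_or_lt with h0 | h0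
    · rw [← h0]
      have : 0 ≤ 4 * lam + 25 := by linarith
      positivity
    · refine le_of_mul_le_mul_right ?_ h0
      nlinarith
  refine Real.sqrt_le_iff.2 ⟨by have : 0 ≤ 4 * lam + 26 := by linarith
                                positivity, h5.trans ?_⟩
  have h6 : n ^ 2 ≤ ((4 * lam + 25) * m) ^ 2 := by gcongr
  nlinarith [sq_nonneg m, mul_nonneg (by linarith : (0 : ℝ) ≤ lam) (sq_nonneg m),
    mul_nonneg (mul_self_nonneg lam) (sq_nonneg m)]

end Hilbert

/-! ### The bilinear form on piecewise twice differentiable functions -/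

/-- `L₂(0,1)`. -/
abbrev L2 := Lp ℝ 2 domainMeasure

lemma scal_eq_inner {f g : ℝ → ℝ} {F G : L2} (hf : f =ᵐ[domainMeasure] F)
    (hg : g =ᵐ[domainMeasure] G) : scal f g = ⟪F, G⟫_ℝ := by
  rw [scal_congr hf hg, scal_comm, L2.inner_def]
  rfl

/-- The class of `g` in `L₂(0,1)`. -/
def toL2 : pieceH2 →ₗ[ℝ] L2 where
  toFun g := (pieceH2.memLp g.2).toLp g
  map_add' _ _ := MemLp.toLp_add _ _
  map_smul' _ _ := MemLp.toLp_const_smul _ _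

/-- The class of `g''` in `L₂(0,1)`. -/
def toL2D2 : pieceH2 →ₗ[ℝ] L2 where
  toFun g := (pieceH2.memLp_d2 g.2).toLp (d2 g)
  map_add' f g := by
    rw [← MemLp.toLp_add]
    exact MemLp.toLp_congr _ _ (pieceH2.d2_add f.2 g.2)
  map_smul' c f := by
    rw [RingHom.id_apply, ← MemLp.toLp_const_smul]
    exact MemLp.toLp_congr _ _ (pieceH2.d2_smul c f.2)

lemma coeFn_toL2 (g : pieceH2) : toL2 g =ᵐ[domainMeasure] g :=
  MemLp.coeFn_toLp (pieceH2.memLp g.2)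

lemma coeFn_toL2D2 (g : pieceH2) : toL2D2 g =ᵐ[domainMeasure] d2 g :=
  MemLp.coeFn_toLp (pieceH2.memLp_d2 g.2)

lemma normSq_eq (g : pieceH2) : normSq g = ‖toL2 g‖ ^ 2 := by
  rw [normSq, scal_eq_inner (coeFn_toL2 g).symm (coeFn_toL2 g).symm, real_inner_self_eq_norm_sq]

lemma normSq_d2_eq (g : pieceH2) : normSq (d2 g) = ‖toL2D2 g‖ ^ 2 := by
  rw [normSq, scal_eq_inner (coeFn_toL2D2 g).symm (coeFn_toL2D2 g).symm,
    real_inner_self_eq_norm_sq]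

lemma inner_toL2D2_comm {u v : pieceH2} (u0 : (u : ℝ → ℝ) 0 = 0) (u1 : (u : ℝ → ℝ) 1 = 0)
    (u0' : d1 u 0 = 0) (u1' : d1 u 1 = 0) : ⟪toL2D2 v, toL2 u⟫_ℝ = ⟪toL2 v, toL2D2 u⟫_ℝ := by
  rw [← scal_eq_inner (coeFn_toL2D2 v).symm (coeFn_toL2 u).symm,
    ← scal_eq_inner (coeFn_toL2 v).symm (coeFn_toL2D2 u).symm]
  exact pieceH2.scal_d2_comm u.2 v.2 u0 u1 u0' u1'

/-- The linear map `(u, v) ↦ a v'' + b u`. -/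
def residual (a b : ℝ) : pieceH2 × pieceH2 →ₗ[ℝ] L2 :=
  a • toL2D2 ∘ₗ LinearMap.snd ℝ _ _ + b • toL2 ∘ₗ LinearMap.fst ℝ _ _

lemma residual_apply (a b : ℝ) (w : pieceH2 × pieceH2) :
    residual a b w = a • toL2D2 w.2 + b • toL2 w.1 := rfl

lemma coeFn_residual (a b : ℝ) (w : pieceH2 × pieceH2) :
    residual a b w =ᵐ[domainMeasure] fun x => a * weakD2 w.2 x + b * (w.1 : ℝ → ℝ) x := by
  rw [residual_apply]
  filter_upwards [Lp.coeFn_add (a • toL2D2 w.2) (b • toL2 w.1), Lp.coeFn_smul a (toL2D2 w.2),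
    Lp.coeFn_smul b (toL2 w.1), coeFn_toL2 w.1, coeFn_toL2D2 w.2,
    pieceH2.weakD2_ae_eq w.2.2 Filter.EventuallyEq.rfl] with x h1 h2 h3 h4 h5 h6
  rw [h1, Pi.add_apply, h2, h3, Pi.smul_apply, Pi.smul_apply, h4, h5, h6]
  rfl

/-- The bilinear form as a bilinear map; `s = √ε`. -/
def bilinMap (lam s : ℝ) :
    pieceH2 × pieceH2 →ₗ[ℝ] pieceH2 × pieceH2 →ₗ[ℝ] ℝ :=
  -- With the two components swapped, this residual is v - s³u''.
  lam • (innerₗ L2).compl₁₂ (residual (-s ^ 3) 1 ∘ₗ (LinearEquiv.prodComm ℝ pieceH2 pieceH2).toLinearMap)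
      (residual (-s ^ 3) 1 ∘ₗ (LinearEquiv.prodComm ℝ pieceH2 pieceH2).toLinearMap) +
    (innerₗ L2).compl₁₂ (residual (s ^ 5) 4) (residual (s ^ 3) 4)

lemma bilinMap_eq_inner (lam s : ℝ) (w z : pieceH2 × pieceH2) : bilinMap lam s w z =
    lam * ⟪residual (-s ^ 3) 1 w.swap, residual (-s ^ 3) 1 z.swap⟫_ℝ +
      ⟪residual (s ^ 5) 4 w, residual (s ^ 3) 4 z⟫_ℝ := rfl

lemma bilinMap_eq (lam s : ℝ) (w z : pieceH2 × pieceH2) : bilinMap lam s w z =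
    hilbertForm lam s (toL2 w.1) (toL2D2 w.1) (toL2 w.2) (toL2D2 w.2)
      (toL2 z.1) (toL2D2 z.1) (toL2 z.2) (toL2D2 z.2) := by
  rw [bilinMap_eq_inner, hilbertForm]
  simp only [residual_apply, Prod.fst_swap, Prod.snd_swap, neg_smul, one_smul,
    neg_add_eq_sub]

lemma rpow_three_half {s : ℝ} (hs : 0 ≤ s) : (s ^ 2) ^ (3 / 2 : ℝ) = s ^ 3 := by
  rw [← Real.rpow_natCast s 2, ← Real.rpow_mul hs, ← Real.rpow_natCast s 3]
  norm_num

lemma rpow_five_half {s : ℝ} (hs : 0 ≤ s) : (s ^ 2) ^ (5 / 2 : ℝ) = s ^ 5 := by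
  rw [← Real.rpow_natCast s 2, ← Real.rpow_mul hs, ← Real.rpow_natCast s 5]
  norm_num

lemma bilin_eq {lam s : ℝ} (hs : 0 ≤ s) (w z : pieceH2 × pieceH2) :
    bilin lam (s ^ 2) w.1 w.2 z.1 z.2 = bilinMap lam s w z := by
  have key : ∀ w : pieceH2 × pieceH2, (fun x => (w.2 : ℝ → ℝ) x - s ^ 3 * weakD2 w.1 x)
      =ᵐ[domainMeasure] residual (-s ^ 3) 1 w.swap := by
    intro w
    filter_upwards [coeFn_residual (-s ^ 3) 1 w.swap] with x hx
    rw [hx]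
    simp only [Prod.fst_swap, Prod.snd_swap]
    ring
  rw [bilin, rpow_three_half hs, rpow_five_half hs, scal_eq_inner (key w) (key z),
    scal_eq_inner (coeFn_residual _ _ w).symm (coeFn_residual _ _ z).symm, bilinMap_eq_inner]

lemma functional_eq {s : ℝ} (hs : 0 ≤ s) {f : ℝ → ℝ} (hf : MemLp f 2 domainMeasure)
    (z : pieceH2 × pieceH2) :
    functional (s ^ 2) f z.1 z.2 = ⟪hf.toLp f, residual (s ^ 3) 4 z⟫_ℝ := by
  rw [functional, rpow_three_half hs,
    scal_eq_inner hf.coeFn_toLp.symm (coeFn_residual _ _ z).symm]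

/-! ### Local interpolation: Taylor polynomials corrected by Hermite cubics -/

open Polynomial in
/-- A polynomial with prescribed derivatives at a point. -/
lemma exists_taylor (n : ℕ) (c : ℕ → ℝ) (a : ℝ) :
    ∃ T : ℝ[X], T.natDegree ≤ n ∧ ∀ j ≤ n, (derivative^[j] T).eval a = c j := by
  set P : ℝ[X] := ∑ k ∈ Finset.range (n + 1), monomial k (c k / (k.factorial : ℝ)) with hP
  refine ⟨taylor (-a) P, ?_, fun j hj => ?_⟩
  · rw [natDegree_taylor]
    refine natDegree_sum_le_of_forall_le _ _ fun k hk => ?_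
    exact (natDegree_monomial_le _).trans (Nat.lt_succ_iff.1 (Finset.mem_range.1 hk))
  · rw [← factorial_smul_hasseDeriv, LinearMap.smul_apply, eval_smul, ← taylor_coeff, taylor_taylor,
      add_neg_cancel, taylor_zero, hP, finsetSum_coeff]
    simp only [coeff_monomial, Finset.sum_ite_eq', Finset.mem_range, Nat.lt_succ_iff, hj, if_true,
      nsmul_eq_mul]
    field_simp

open Polynomial in
/-- The cubic with zero Hermite data at `a` and Hermite data `α, β` at `b`. -/
lemma exists_cubic {a b : ℝ} (hab : a ≠ b) (α β : ℝ) :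
    ∃ c : ℝ[X], c.natDegree ≤ 3 ∧ c.eval a = 0 ∧ c.derivative.eval a = 0 ∧ c.eval b = α ∧
      c.derivative.eval b = β ∧ ∀ x ∈ uIcc a b, |c.eval x| ≤ |α| + |b - a| * |β| ∧
        |c.derivative.derivative.eval x| ≤ 6 * |α| / |b - a| ^ 2 + 4 * |β| / |b - a| := by
  obtain ⟨h, rfl⟩ : ∃ h, b = a + h := ⟨b - a, by ring⟩
  have hh : h ≠ 0 := by
    rintro rfl
    simp at hab
  -- In the variable y = (x - a)/h this is α(3y² - 2y³) + hβ(y³ - y²), the Hermite basis belonging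
  -- to y = 1.
  refine ⟨C (3 * α / h ^ 2 - β / h) * (X - C a) ^ 2 +
    C (-2 * α / h ^ 3 + β / h ^ 2) * (X - C a) ^ 3, by compute_degree, by simp, by simp [derivative_pow], ?_, ?_,
    fun x hx => ?_⟩
  · simp
    field_simp
    ring
  · simp [derivative_pow]
    field_simp
    ring
  · rw [← segment_eq_uIcc, segment_eq_image'] at hx
    obtain ⟨y, hy, rfl⟩ := hx
    rw [add_sub_cancel_left]
    simp only [smul_eq_mul]
    have hp : 0 < |h| := abs_pos.2 hh
    constructor
    · have e : eval (a + y * h) (C (3 * α / h ^ 2 - β / h) * (X - C a) ^ 2 +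
          C (-2 * α / h ^ 3 + β / h ^ 2) * (X - C a) ^ 3) =
          α * (3 * y ^ 2 - 2 * y ^ 3) + h * β * (y ^ 3 - y ^ 2) := by
        simp
        field_simp
        ring
      rw [e]
      have b1 : |3 * y ^ 2 - 2 * y ^ 3| ≤ 1 := by
        rw [abs_le]
        constructor <;> nlinarith [hy.1, hy.2, sq_nonneg y, sq_nonneg (1 - y),
          mul_nonneg hy.1 (sq_nonneg y), mul_nonneg (sub_nonneg.2 hy.2) (sq_nonneg y),
          mul_nonneg hy.1 (sq_nonneg (1 - y))]
      have b2 : |y ^ 3 - y ^ 2| ≤ 1 := by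
        rw [abs_le]
        constructor <;> nlinarith [hy.1, hy.2, sq_nonneg y, sq_nonneg (1 - y),
          mul_nonneg hy.1 (sq_nonneg y), mul_nonneg (sub_nonneg.2 hy.2) (sq_nonneg y)]
      calc _ ≤ |α * (3 * y ^ 2 - 2 * y ^ 3)| + |h * β * (y ^ 3 - y ^ 2)| := abs_add_le _ _
        _ = |α| * |3 * y ^ 2 - 2 * y ^ 3| + |h| * |β| * |y ^ 3 - y ^ 2| := by simp only [abs_mul]
        _ ≤ |α| * 1 + |h| * |β| * 1 := by gcongr
        _ = _ := by ring
    · have e : eval (a + y * h) (derivative (derivative (C (3 * α / h ^ 2 - β / h) * (X - C a) ^ 2 +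
          C (-2 * α / h ^ 3 + β / h ^ 2) * (X - C a) ^ 3))) =
          α / h ^ 2 * (6 - 12 * y) + β / h * (6 * y - 2) := by
        simp [derivative_pow]
        field_simp
        ring
      rw [e]
      have b1 : |6 - 12 * y| ≤ 6 := by
        rw [abs_le]
        constructor <;> linarith [hy.1, hy.2]
      have b2 : |6 * y - 2| ≤ 4 := by
        rw [abs_le]
        constructor <;> linarith [hy.1, hy.2]
      calc _ ≤ |α / h ^ 2 * (6 - 12 * y)| + |β / h * (6 * y - 2)| := abs_add_le _ _
        _ = |α| / |h| ^ 2 * |6 - 12 * y| + |β| / |h| * |6 * y - 2| := by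
          simp only [abs_mul, abs_div, abs_pow]
        _ ≤ |α| / |h| ^ 2 * 6 + |β| / |h| * 4 := by gcongr
        _ = _ := by ring

/-- `F (k + 1)` is the derivative of `F k` on `[0,1]` for all `k < n`. -/
def IsTower (n : ℕ) (F : ℕ → ℝ → ℝ) : Prop :=
  ∀ k < n, ∀ x ∈ Icc (0 : ℝ) 1, HasDerivWithinAt (F k) (F (k + 1) x) (Icc 0 1) x

/-- The remainder bound in Taylor's formula, for all derivatives. -/
lemma tower_bound {n : ℕ} {R : ℕ → ℝ → ℝ} {a b K : ℝ} (hab : a ≤ b)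
    (hR : ∀ k < n, ∀ x ∈ Icc a b, HasDerivWithinAt (R k) (R (k + 1) x) (Icc a b) x)
    (h0 : ∀ k < n, R k a = 0) (hK : ∀ x ∈ Icc a b, |R n x| ≤ K) :
    ∀ i ≤ n, ∀ x ∈ Icc a b, |R (n - i) x| ≤ K * (b - a) ^ i := by
  have hK0 : 0 ≤ K := (abs_nonneg _).trans (hK a (left_mem_Icc.2 hab))
  intro i
  induction i with
  | zero => simpa using hK
  | succ i ih =>
    intro hi x hx
    have e : n - (i + 1) + 1 = n - i := by omega
    have hd := hR (n - (i + 1)) (by omega)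
    rw [e] at hd
    -- Each integration from `a`, where all derivatives of the remainder below order `n` vanish,
    -- costs one factor b - a; the factorials of Taylor's formula are given away.
    have := (convex_Icc a b).norm_image_sub_le_of_norm_hasDerivWithin_le hd (ih (by omega))
      (left_mem_Icc.2 hab) hx
    rw [h0 _ (by omega), sub_zero, Real.norm_eq_abs, Real.norm_eq_abs,
      abs_of_nonneg (sub_nonneg.2 hx.1)] at this
    have hba : 0 ≤ b - a := sub_nonneg.2 hab
    calc |R (n - (i + 1)) x| ≤ K * (b - a) ^ i * (x - a) := this
      _ ≤ K * (b - a) ^ i * (b - a) := by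
        gcongr
        exact hx.2
      _ = K * (b - a) ^ (i + 1) := by ring

open Polynomial in
/-- Hermite type interpolation of degree `p`: a Taylor polynomial at `a`, corrected by a cubic. -/
lemma exists_interpolant {p : ℕ} (hp : 3 ≤ p) {F : ℕ → ℝ → ℝ} (hF : IsTower (p + 1) F) {a b : ℝ}
    (ha : 0 ≤ a) (hab : a < b) (hb : b ≤ 1) :
    ∃ q : ℝ[X], q.natDegree ≤ p ∧ q.eval a = F 0 a ∧ q.derivative.eval a = F 1 a ∧
      q.eval b = F 0 b ∧ q.derivative.eval b = F 1 b ∧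
      ∀ K : ℝ, (∀ x ∈ Icc a b, |F (p + 1) x| ≤ K) → ∀ x ∈ Icc a b,
        |F 0 x - q.eval x| ≤ 3 * K * (b - a) ^ (p + 1) ∧
        |F 2 x - q.derivative.derivative.eval x| ≤ 11 * K * (b - a) ^ (p - 1) := by
  obtain ⟨T, hT, hTa⟩ := exists_taylor p (fun k => F k a) a
  set R : ℕ → ℝ → ℝ := fun k x => F k x - (derivative^[k] T).eval x with hR
  -- The cubic takes up the Taylor remainder at `b` and leaves the Hermite data at `a` untouched.
  obtain ⟨c, hc, ca, ca', cb, cb', hcx⟩ := exists_cubic hab.ne (R 0 b) (R 1 b)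
  have hsub : Icc a b ⊆ Icc 0 1 := Icc_subset_Icc ha hb
  have hh : 0 < b - a := sub_pos.2 hab
  refine ⟨T + c, (natDegree_add_le _ _).trans (max_le hT (hc.trans hp)), ?_, ?_, ?_, ?_, ?_⟩
  · simpa [ca] using hTa 0 (by omega)
  · simpa [ca'] using hTa 1 (by omega)
  · simp [cb, hR]
  · simp [cb', hR]
  intro K hK
  have hb1 := tower_bound (n := p + 1) (R := R) (K := K) hab.le ?_ ?_ ?_
  rotate_left
  · intro k hk x hx
    have := ((hF k hk x (hsub hx)).mono hsub).sub
      ((derivative^[k] T).hasDerivAt x).hasDerivWithinAt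
    simp only [hR, Function.iterate_succ_apply']
    exact this
  · intro k hk
    simp [hR, hTa k (by omega)]
  · intro x hx
    simpa [hR, iterate_derivative_eq_zero (show T.natDegree < p + 1 by omega)] using hK x hx
  have r0 : ∀ x ∈ Icc a b, |R 0 x| ≤ K * (b - a) ^ (p + 1) := by
    simpa using hb1 (p + 1) le_rfl
  have r1 : ∀ x ∈ Icc a b, |R 1 x| ≤ K * (b - a) ^ p := by
    simpa using hb1 p (by omega)
  have r2 : ∀ x ∈ Icc a b, |R 2 x| ≤ K * (b - a) ^ (p - 1) := by
    have := hb1 (p - 1) (by omega)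
    rwa [show p + 1 - (p - 1) = 2 by omega] at this
  have s0 := r0 b (right_mem_Icc.2 hab.le)
  have s1 := r1 b (right_mem_Icc.2 hab.le)
  intro x hx
  obtain ⟨c0, c2⟩ := hcx x (by rwa [uIcc_of_le hab.le])
  rw [abs_of_pos hh] at c0 c2
  have e0 : F 0 x - (T + c).eval x = R 0 x - c.eval x := by
    simp only [hR, eval_add, Function.iterate_zero, id]
    ring
  have e2 : F 2 x - (derivative (derivative (T + c))).eval x =
      R 2 x - (derivative (derivative c)).eval x := by
    simp only [hR, derivative_add, eval_add, Function.iterate_succ_apply', Function.iterate_zero, id]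
    ring
  have pe : (b - a) ^ p = (b - a) * (b - a) ^ (p - 1) := by
    rw [← pow_succ']
    congr 1
    omega
  -- The Taylor remainder contributes 1 to both bounds, the cubic 1 + 1 to the values and 6 + 4 to
  -- the second derivative; hence 3 and 11.
  constructor
  · rw [e0]
    have : (b - a) * |R 1 b| ≤ K * (b - a) ^ (p + 1) := by
      calc (b - a) * |R 1 b| ≤ (b - a) * (K * (b - a) ^ p) := by gcongr
        _ = _ := by ring
    have h1 := abs_sub (R 0 x) (c.eval x)
    linarith [r0 x hx]
  · rw [e2]
    have i1 : 6 * |R 0 b| / (b - a) ^ 2 ≤ 6 * (K * (b - a) ^ (p - 1)) := by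
      rw [div_le_iff₀ (by positivity)]
      calc 6 * |R 0 b| ≤ 6 * (K * (b - a) ^ (p + 1)) := by gcongr
        _ = _ := by rw [pow_succ, pe]; ring
    have i2 : 4 * |R 1 b| / (b - a) ≤ 4 * (K * (b - a) ^ (p - 1)) := by
      rw [div_le_iff₀ hh]
      calc 4 * |R 1 b| ≤ 4 * (K * (b - a) ^ p) := by gcongr
        _ = _ := by rw [pe]; ring
    have h1 := abs_sub (R 2 x) (c.derivative.derivative.eval x)
    linarith [r2 x hx]

/-! ### Meshes and splines -/

/-- `x 0 < x 1 < ⋯ < x N` is a partition of `[0,1]`. -/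
structure IsMesh (N : ℕ) (x : ℕ → ℝ) : Prop where
  zero : x 0 = 0
  last : x N = 1
  lt : ∀ i < N, x i < x (i + 1)

lemma monotone_of_lt_succ {n : ℕ} {x : ℕ → ℝ} (h : ∀ i < n, x i < x (i + 1)) {i j : ℕ}
    (hij : i ≤ j) (hj : j ≤ n) : x i ≤ x j := by
  induction j, hij using Nat.le_induction with
  | base => exact le_rfl
  | succ j _ ih => exact (ih (by omega)).trans (h j (by omega)).le

section Mesh

variable {p N : ℕ} {x : ℕ → ℝ} {s : ℝ → ℝ}

lemma IsMesh.mono (hx : IsMesh N x) {i j : ℕ} (hij : i ≤ j) (hj : j ≤ N) : x i ≤ x j :=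
  monotone_of_lt_succ hx.lt hij hj

lemma IsMesh.pos (hx : IsMesh N x) : 0 < N := by
  rcases Nat.eq_zero_or_pos N with h | h
  · have h0 := hx.zero
    have h1 := hx.last
    rw [h, h0] at h1
    norm_num at h1
  · exact h

lemma IsMesh.nonneg (hx : IsMesh N x) {i : ℕ} (hi : i ≤ N) : 0 ≤ x i :=
  hx.zero ▸ hx.mono (Nat.zero_le i) hi

lemma IsMesh.le_one (hx : IsMesh N x) {i : ℕ} (hi : i ≤ N) : x i ≤ 1 :=
  hx.last ▸ hx.mono hi le_rfl

lemma IsMesh.Ioo_subset (hx : IsMesh N x) {i : ℕ} (hi : i < N) :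
    Ioo (x i) (x (i + 1)) ⊆ Ioo 0 1 :=
  Ioo_subset_Ioo (hx.nonneg hi.le) (hx.le_one hi)

lemma IsMesh.exists_mem_Ioo (hx : IsMesh N x) {t : ℝ} (ht : t ∈ Ioo (0 : ℝ) 1 \ range x) :
    ∃ i < N, t ∈ Ioo (x i) (x (i + 1)) := by
  classical
  have hex : ∃ j, t < x j := ⟨N, hx.last ▸ ht.1.2⟩
  have hne : Nat.find hex ≠ 0 := by
    intro h
    have := Nat.find_spec hex
    rw [h, hx.zero] at this
    exact lt_asymm this ht.1.1
  obtain ⟨i, hi⟩ := Nat.exists_eq_succ_of_ne_zero hne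
  have hle : Nat.find hex ≤ N := Nat.find_min' hex (hx.last ▸ ht.1.2)
  refine ⟨i, by omega, ?_, by rw [← Nat.succ_eq_add_one, ← hi]; exact Nat.find_spec hex⟩
  have := Nat.find_min hex (m := i) (by omega)
  exact lt_of_le_of_ne (not_lt.1 this) fun h => ht.2 ⟨i, h⟩

open Polynomial in
lemma hasDerivAt_d1_of_eqOn {a b : ℝ} (hab : Ioo a b ⊆ Ioo 0 1) {q : ℝ[X]}
    (hs : ∀ t ∈ Ioo a b, s t = q.eval t) {t : ℝ} (ht : t ∈ Ioo a b) :
    HasDerivAt (d1 s) (q.derivative.derivative.eval t) t := by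
  refine (q.derivative.hasDerivAt t).congr_of_eventuallyEq ?_
  filter_upwards [isOpen_Ioo.mem_nhds ht] with y hy
  have hy' := hab hy
  have : HasDerivAt s (q.derivative.eval y) y := by
    refine (q.hasDerivAt y).congr_of_eventuallyEq ?_
    filter_upwards [isOpen_Ioo.mem_nhds hy] with z hz using hs z hz
  exact this.hasDerivWithinAt.derivWithin (uniqueDiffOn_unit y (Ioo_subset_Icc_self hy'))

lemma IsSpline.mem_pieceH2 (hx : IsMesh N x) (hs : IsSpline p 1 N x s) : s ∈ pieceH2 := by
  choose! q hq using hs.2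
  have hB : ∀ i, ∃ B, ∀ t ∈ Icc (0 : ℝ) 1, |(q i).derivative.derivative.eval t| ≤ B := fun i =>
    isCompact_Icc.exists_bound_of_continuousOn (q i).derivative.derivative.continuousOn
  choose B hB using hB
  -- The exceptional set consists of the nodes; the sum of the nonnegative bounds for the pieces
  -- dominates each of them.
  refine ⟨by simpa using hs.1, range x, countable_range x, ∑ i ∈ Finset.range N, B i,
    fun t ht => ?_⟩
  obtain ⟨i, hi, hti⟩ := hx.exists_mem_Ioo ht
  have h := hasDerivAt_d1_of_eqOn (hx.Ioo_subset hi) (hq i hi).2 hti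
  refine ⟨h.differentiableAt, ?_⟩
  rw [show d2 s t = _ from h.deriv]
  refine (hB i t (Ioo_subset_Icc_self ht.1)).trans ?_
  exact Finset.single_le_sum (f := B)
    (fun j _ => (abs_nonneg _).trans (hB j 0 (left_mem_Icc.2 zero_le_one))) (Finset.mem_range.2 hi)

/-- A double zero at `a` makes value and slope match those of the zero function. Such truncated
polynomials are the increments from one spline piece to the next. -/
lemma contDiff_truncated {a : ℝ} {P : ℝ[X]} (h0 : P.eval a = 0) (h1 : P.derivative.eval a = 0) :
    ContDiff ℝ 1 fun t => if t ≤ a then 0 else P.eval t := by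
  have key : ∀ (Q : ℝ[X]), Q.eval a = 0 →
      (∀ t ∈ Ici a, (if t ≤ a then 0 else Q.eval t) = Q.eval t) := by
    intro Q hQ t ht
    split_ifs with h
    · rw [le_antisymm h ht, hQ]
    · rfl
  have hd : ∀ t, HasDerivAt (fun t => if t ≤ a then 0 else P.eval t)
      (if t ≤ a then 0 else P.derivative.eval t) t := by
    intro t
    rcases lt_trichotomy t a with h | h | h
    · rw [if_pos h.le]
      refine (hasDerivAt_const t (0 : ℝ)).congr_of_eventuallyEq ?_
      filter_upwards [Iio_mem_nhds h] with y hy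
      exact if_pos (le_of_lt hy)
    · subst h
      rw [if_pos le_rfl, ← hasDerivWithinAt_univ, ← Iic_union_Ici (a := t)]
      refine HasDerivWithinAt.union ?_ ?_
      · exact (hasDerivWithinAt_const t _ (0 : ℝ)).congr (fun y hy => if_pos hy) (if_pos le_rfl)
      · have := (P.hasDerivAt t).hasDerivWithinAt (s := Ici t)
        rw [h1] at this
        exact this.congr (key P h0) (key P h0 t self_mem_Ici)
    · rw [if_neg h.not_ge]
      refine (P.hasDerivAt t).congr_of_eventuallyEq ?_
      filter_upwards [Ioi_mem_nhds h] with y hy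
      exact if_neg (not_le.2 hy)
  rw [contDiff_one_iff_deriv]
  refine ⟨fun t => (hd t).differentiableAt, ?_⟩
  rw [funext fun t => (hd t).deriv]
  refine Continuous.if_le continuous_const P.derivative.continuous continuous_id continuous_const ?_
  rintro t rfl
  exact h1.symm

/-- Gluing polynomials with matching Hermite data. -/
lemma exists_glue {n : ℕ} {q : ℕ → ℝ[X]} (hx : ∀ i < n, x i < x (i + 1))
    (h0 : ∀ i < n, (q i).eval (x (i + 1)) = (q (i + 1)).eval (x (i + 1)))
    (h1 : ∀ i < n, (q i).derivative.eval (x (i + 1)) = (q (i + 1)).derivative.eval (x (i + 1))) :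
    ∃ s : ℝ → ℝ, ContDiff ℝ 1 s ∧ (∀ i < n, ∀ t ∈ Icc (x i) (x (i + 1)), s t = (q i).eval t) ∧
      ∀ t, x n ≤ t → s t = (q n).eval t := by
  induction n with
  | zero => exact ⟨fun t => (q 0).eval t,
      by simpa [Polynomial.coe_aeval_eq_eval] using (q 0).contDiff_aeval (𝕜 := ℝ) 1, by simp, by simp⟩
  | succ n ih =>
    obtain ⟨s, hs, hs1, hs2⟩ := ih (fun i hi => hx i (by omega)) (fun i hi => h0 i (by omega))
      (fun i hi => h1 i (by omega))
    have hn := hx n (by omega)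
    -- The difference of consecutive pieces has a double zero at their common node; adding its
    -- truncation changes nothing to the left.
    have htr := contDiff_truncated (a := x (n + 1)) (P := q (n + 1) - q n)
      (by simp [h0 n (by omega)]) (by simp [h1 n (by omega)])
    refine ⟨_, hs.add htr, fun i hi t ht => ?_, fun t ht => ?_⟩
    · have ht' : t ≤ x (n + 1) := ht.2.trans (monotone_of_lt_succ hx (by omega) le_rfl)
      simp only [if_pos ht', add_zero]
      rcases Nat.lt_succ_iff_lt_or_eq.1 hi with h | rfl
      · exact hs1 i h t ht
      · exact hs2 t ht.1
    · have e := hs2 t (hn.le.trans ht)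
      simp only [e]
      split_ifs with h
      · rw [le_antisymm h ht, add_zero, h0 n (by omega)]
      · simp

/-- The spline with given pieces that have common Hermite data `y i, z i` at the nodes. -/
lemma IsMesh.exists_spline (hx : IsMesh N x) {q : ℕ → ℝ[X]} (hq : ∀ i < N, (q i).natDegree ≤ p)
    {y z : ℕ → ℝ}
    (h : ∀ i < N, (q i).eval (x i) = y i ∧ (q i).derivative.eval (x i) = z i ∧
      (q i).eval (x (i + 1)) = y (i + 1) ∧ (q i).derivative.eval (x (i + 1)) = z (i + 1)) :
    ∃ s : ℝ → ℝ, IsSpline p 1 N x s ∧ s 0 = y 0 ∧ d1 s 0 = z 0 ∧ s 1 = y N ∧ d1 s 1 = z N ∧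
      ∀ i < N, ∀ t ∈ Ioo (x i) (x (i + 1)),
        s t = (q i).eval t ∧ d2 s t = (q i).derivative.derivative.eval t := by
  obtain ⟨n, rfl⟩ : ∃ n, N = n + 1 := ⟨N - 1, by have := hx.pos; omega⟩
  obtain ⟨s, hs, hs1, hs2⟩ := exists_glue (n := n) (q := q) (fun i hi => hx.lt i (by omega))
    (fun i hi => by rw [(h i (by omega)).2.2.1, (h (i + 1) (by omega)).1])
    (fun i hi => by rw [(h i (by omega)).2.2.2, (h (i + 1) (by omega)).2.1])
  have hpc : ∀ i < n + 1, ∀ t ∈ Icc (x i) (x (i + 1)), s t = (q i).eval t := by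
    intro i hi t ht
    rcases Nat.lt_succ_iff_lt_or_eq.1 hi with h | rfl
    · exact hs1 i h t ht
    · exact hs2 t ht.1
  have hd : ∀ i < n + 1, ∀ t ∈ Icc (x i) (x (i + 1)), deriv s t = (q i).derivative.eval t := by
    intro i hi t ht
    have hu := uniqueDiffOn_Icc (hx.lt i hi) t ht
    rw [← (hs.differentiable one_ne_zero t).derivWithin hu]
    exact (((q i).hasDerivAt t).hasDerivWithinAt.congr (hpc i hi) (hpc i hi t ht)).derivWithin hu
  have hd1 : ∀ t ∈ Icc (0 : ℝ) 1, d1 s t = deriv s t := fun t ht =>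
    (hs.differentiable one_ne_zero t).derivWithin (uniqueDiffOn_unit t ht)
  have hl : (0 : ℝ) ∈ Icc (x 0) (x (0 + 1)) := by
    rw [← hx.zero]
    exact left_mem_Icc.2 (hx.lt 0 (by omega)).le
  have hr : (1 : ℝ) ∈ Icc (x n) (x (n + 1)) := by
    rw [← hx.last]
    exact right_mem_Icc.2 (hx.lt n (by omega)).le
  refine ⟨s, ⟨by simpa using hs.contDiffOn, fun i hi => ⟨q i, hq i hi, fun t ht =>
    hpc i hi t (Ioo_subset_Icc_self ht)⟩⟩, ?_, ?_, ?_, ?_, fun i hi t ht => ⟨hpc i hi t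
      (Ioo_subset_Icc_self ht), ?_⟩⟩
  · rw [hpc 0 (by omega) 0 hl, ← (h 0 (by omega)).1, hx.zero]
  · rw [hd1 0 (by simp), hd 0 (by omega) 0 hl, ← (h 0 (by omega)).2.1, hx.zero]
  · rw [hpc n (by omega) 1 hr, ← (h n (by omega)).2.2.1, hx.last]
  · rw [hd1 1 (by simp), hd n (by omega) 1 hr, ← (h n (by omega)).2.2.2, hx.last]
  · exact (hasDerivAt_d1_of_eqOn (hx.Ioo_subset hi)
      (fun t ht => hpc i hi t (Ioo_subset_Icc_self ht)) ht).deriv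

end Mesh

/-! ### The Shishkin mesh -/

section Shishkin

variable {σ ε : ℝ} {m : ℕ}

lemma transition_le (σ ε : ℝ) (N : ℕ) : transition σ ε N ≤ 1 / 4 := min_le_left _ _

/-- Since N = 4m ≥ 4 > e. This lets lower powers of ln N be absorbed by higher ones. -/
lemma one_le_log {m : ℕ} (hm : 0 < m) : 1 ≤ Real.log ((4 * m : ℕ) : ℝ) := by
  rw [Real.le_log_iff_exp_le (by positivity)]
  have : (1 : ℝ) ≤ m := by exact_mod_cast hm
  push_cast
  linarith [Real.exp_one_lt_d9]

lemma transition_pos (hσ : 0 < σ) (hε : 0 < ε) (hm : 0 < m) : 0 < transition σ ε (4 * m) := by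
  have := one_le_log hm
  unfold transition
  positivity

lemma node_left {i : ℕ} (hi : i ≤ m) :
    node σ ε (4 * m) i = i * (transition σ ε (4 * m) / m) := by
  have h : 4 * i ≤ 4 * m := by omega
  simp only [node, if_pos h]
  congr 2
  push_cast
  ring

/-- The outer and inner formulas agree at the transition node i = m, which `node` assigns to the
left branch, so the middle formula holds there too. -/
lemma node_mid (hm : 0 < m) {i : ℕ} (hi : m ≤ i) (hi' : i ≤ 3 * m) : node σ ε (4 * m) i =
    transition σ ε (4 * m) + (i - m) * ((1 - 2 * transition σ ε (4 * m)) / (2 * m)) := by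
  have hm' : (m : ℝ) ≠ 0 := by positivity
  rcases hi.eq_or_lt with rfl | h
  · rw [node_left le_rfl]
    field_simp
    ring
  · have h1 : ¬ 4 * i ≤ 4 * m := by omega
    have h2 : 4 * i ≤ 3 * (4 * m) := by omega
    simp only [node, if_neg h1, if_pos h2]
    push_cast
    congr 2
    · ring
    · congr 1
      ring

lemma node_right (hm : 0 < m) {i : ℕ} (hi : 3 * m ≤ i) : node σ ε (4 * m) i =
    1 - transition σ ε (4 * m) + (i - 3 * m) * (transition σ ε (4 * m) / m) := by
  have hm' : (m : ℝ) ≠ 0 := by positivity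
  rcases hi.eq_or_lt with rfl | h
  · rw [node_mid hm (by omega) le_rfl]
    push_cast
    field_simp
    ring
  · have h1 : ¬ 4 * i ≤ 4 * m := by omega
    have h2 : ¬ 4 * i ≤ 3 * (4 * m) := by omega
    simp only [node, if_neg h1, if_neg h2]
    push_cast
    congr 2
    · ring
    · congr 1
      ring

lemma node_succ_left {i : ℕ} (hi : i < m) :
    node σ ε (4 * m) (i + 1) = node σ ε (4 * m) i + transition σ ε (4 * m) / m := by
  rw [node_left hi, node_left hi.le]
  push_cast
  ring

lemma node_succ_mid (hm : 0 < m) {i : ℕ} (hi : m ≤ i) (hi' : i < 3 * m) :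
    node σ ε (4 * m) (i + 1) =
      node σ ε (4 * m) i + (1 - 2 * transition σ ε (4 * m)) / (2 * m) := by
  rw [node_mid hm (by omega) hi', node_mid hm hi hi'.le]
  push_cast
  ring

lemma node_succ_right (hm : 0 < m) {i : ℕ} (hi : 3 * m ≤ i) :
    node σ ε (4 * m) (i + 1) = node σ ε (4 * m) i + transition σ ε (4 * m) / m := by
  rw [node_right hm (by omega), node_right hm hi]
  push_cast
  ring

lemma node_transition_left (hm : 0 < m) : node σ ε (4 * m) m = transition σ ε (4 * m) := by
  rw [node_left le_rfl]
  field_simp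

lemma node_transition_right (hm : 0 < m) :
    node σ ε (4 * m) (3 * m) = 1 - transition σ ε (4 * m) := by
  rw [node_right hm le_rfl]
  push_cast
  ring

lemma isMesh_node (hσ : 0 < σ) (hε : 0 < ε) (hm : 0 < m) : IsMesh (4 * m) (node σ ε (4 * m)) := by
  have ht := transition_pos hσ hε hm
  have ht' := transition_le σ ε (4 * m)
  have hm' : (0 : ℝ) < m := by exact_mod_cast hm
  refine ⟨by rw [node_left (Nat.zero_le _)]; simp, ?_, fun i _ => ?_⟩
  · rw [node_right hm (by omega)]
    push_cast
    field_simp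
    ring
  · rcases lt_or_ge i m with h | h
    · rw [node_succ_left h]
      exact lt_add_of_pos_right _ (by positivity)
    · rcases lt_or_ge i (3 * m) with h' | h'
      · rw [node_succ_mid hm h h']
        exact lt_add_of_pos_right _ (div_pos (by linarith) (by positivity))
      · rw [node_succ_right hm h']
        exact lt_add_of_pos_right _ (by positivity)

/-- Fine cells have length at most 1/N because τ ≤ 1/4; the factor 2 comes from the coarse cells, of
which there are N/2. -/
lemma node_succ_sub_le (hσ : 0 < σ) (hε : 0 < ε) (hm : 0 < m) (i : ℕ) :
    node σ ε (4 * m) (i + 1) - node σ ε (4 * m) i ≤ 2 * ((4 * m : ℕ) : ℝ)⁻¹ := by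
  have ht := transition_pos hσ hε hm
  have ht' := transition_le σ ε (4 * m)
  have hm' : (0 : ℝ) < m := by exact_mod_cast hm
  have e : 2 * ((4 * m : ℕ) : ℝ)⁻¹ = 1 / (2 * m) := by
    push_cast
    field_simp
    norm_num
  rw [e]
  rcases lt_or_ge i m with h | h
  · rw [node_succ_left h, add_sub_cancel_left, div_le_div_iff₀ hm' (by positivity)]
    nlinarith
  · rcases lt_or_ge i (3 * m) with h' | h'
    · rw [node_succ_mid hm h h', add_sub_cancel_left]
      gcongr
      linarith
    · rw [node_succ_right hm h', add_sub_cancel_left, div_le_div_iff₀ hm' (by positivity)]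
      nlinarith

end Shishkin

/-! ### Interpolation of smooth functions and of layer functions -/

section Interpolation

variable {p N : ℕ} {x : ℕ → ℝ} {F : ℕ → ℝ → ℝ}

lemma IsMesh.exists_interpolants (hx : IsMesh N x) (hp : 3 ≤ p) (hF : IsTower (p + 1) F) :
    ∃ q : ℕ → ℝ[X], ∀ i < N, (q i).natDegree ≤ p ∧ (q i).eval (x i) = F 0 (x i) ∧
      (q i).derivative.eval (x i) = F 1 (x i) ∧ (q i).eval (x (i + 1)) = F 0 (x (i + 1)) ∧
      (q i).derivative.eval (x (i + 1)) = F 1 (x (i + 1)) ∧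
      ∀ K : ℝ, (∀ t ∈ Icc (x i) (x (i + 1)), |F (p + 1) t| ≤ K) → ∀ t ∈ Icc (x i) (x (i + 1)),
        |F 0 t - (q i).eval t| ≤ 3 * K * (x (i + 1) - x i) ^ (p + 1) ∧
        |F 2 t - (q i).derivative.derivative.eval t| ≤ 11 * K * (x (i + 1) - x i) ^ (p - 1) := by
  have : ∀ i, ∃ q : ℝ[X], i < N → _ := fun i => by
    by_cases hi : i < N
    · obtain ⟨q, hq⟩ := exists_interpolant hp hF (hx.nonneg hi.le) (hx.lt i hi) (hx.le_one hi)
      exact ⟨q, fun _ => hq⟩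
    · exact ⟨0, fun h => absurd h hi⟩
  choose q hq using this
  exact ⟨q, hq⟩

/-- Sum of the two boundary layer functions. -/
def layer (ε x : ℝ) : ℝ := Real.exp (-(x / ε)) + Real.exp (-((1 - x) / ε))

lemma layer_pos (ε x : ℝ) : 0 < layer ε x := by
  unfold layer
  positivity

/-- Each exponential changes by at most the factor e^θ over a distance θε. The maximum over a cell
can thus be replaced by the value at the point considered, which keeps the decay to be integrated
later. -/
lemma layer_le {ε θ x y : ℝ} (hε : 0 < ε) (h : |x - y| ≤ θ * ε) :
    layer ε y ≤ Real.exp θ * layer ε x := by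
  rw [abs_le] at h
  unfold layer
  rw [mul_add, ← Real.exp_add, ← Real.exp_add]
  gcongr
  · have : (x - y) / ε ≤ θ := by
      rw [div_le_iff₀ hε]
      exact h.2
    rw [sub_div] at this
    linarith
  · have : (y - x) / ε ≤ θ := by
      rw [div_le_iff₀ hε]
      linarith [h.1]
    rw [sub_div] at this
    rw [sub_div, sub_div]
    linarith

/-- Bounds for derivatives of layer functions. -/
def IsLayerTower (n : ℕ) (ε M : ℝ) (F : ℕ → ℝ → ℝ) : Prop :=
  IsTower n F ∧ ∀ k ≤ n, ∀ x ∈ Icc (0 : ℝ) 1, |F k x| ≤ M * (ε ^ k)⁻¹ * layer ε x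

/-- On a cell of length at most θε the powers of the length cancel the factor ε^{-(p+1)} of the
highest derivative, leaving no power of ε for the values and ε^{-2} for the second derivative. -/
lemma interpolant_layer_bound {ε M θ : ℝ} (hε : 0 < ε) (hM : 0 ≤ M)
    (hF : IsLayerTower (p + 1) ε M F) (hp : 1 ≤ p) {a b : ℝ} (ha : 0 ≤ a) (hb : b ≤ 1)
    (hθ : b - a ≤ θ * ε) {q : ℝ[X]}
    (hq : ∀ K : ℝ, (∀ t ∈ Icc a b, |F (p + 1) t| ≤ K) → ∀ t ∈ Icc a b,
        |F 0 t - q.eval t| ≤ 3 * K * (b - a) ^ (p + 1) ∧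
        |F 2 t - q.derivative.derivative.eval t| ≤ 11 * K * (b - a) ^ (p - 1))
    {t : ℝ} (ht : t ∈ Icc a b) :
    |F 0 t - q.eval t| ≤ 3 * M * Real.exp θ * θ ^ (p + 1) * layer ε t ∧
      |F 2 t - q.derivative.derivative.eval t| ≤
        11 * M * Real.exp θ * θ ^ (p - 1) * (ε ^ 2)⁻¹ * layer ε t := by
  have hL := layer_pos ε t
  have hba : 0 ≤ b - a := sub_nonneg.2 (ht.1.trans ht.2)
  have hK : ∀ y ∈ Icc a b, |F (p + 1) y| ≤ M * (ε ^ (p + 1))⁻¹ * (Real.exp θ * layer ε t) := by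
    intro y hy
    refine (hF.2 (p + 1) le_rfl y ⟨ha.trans hy.1, hy.2.trans hb⟩).trans ?_
    gcongr
    refine layer_le hε (le_trans ?_ hθ)
    rw [abs_le]
    constructor <;> linarith [ht.1, ht.2, hy.1, hy.2]
  obtain ⟨h0, h2⟩ := hq _ hK t ht
  constructor
  · refine h0.trans ?_
    calc _ ≤ 3 * (M * (ε ^ (p + 1))⁻¹ * (Real.exp θ * layer ε t)) * (θ * ε) ^ (p + 1) := by
          gcongr
      _ = _ := by
          rw [mul_pow]
          field_simp
  · refine h2.trans ?_
    calc _ ≤ 11 * (M * (ε ^ (p + 1))⁻¹ * (Real.exp θ * layer ε t)) * (θ * ε) ^ (p - 1) := by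
          gcongr
      _ = _ := by
          rw [mul_pow, show p + 1 = (p - 1) + 2 by omega, pow_add]
          field_simp

/-- Interpolation of a function with a bounded derivative of order `p + 1`. -/
lemma IsMesh.exists_spline_smooth (hx : IsMesh N x) (hp : 3 ≤ p) (hF : IsTower (p + 1) F)
    {K H : ℝ} (hK : ∀ t ∈ Icc (0 : ℝ) 1, |F (p + 1) t| ≤ K)
    (hH : ∀ i < N, x (i + 1) - x i ≤ H) :
    ∃ s : ℝ → ℝ, IsSpline p 1 N x s ∧ s 0 = F 0 0 ∧ d1 s 0 = F 1 0 ∧ s 1 = F 0 1 ∧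
      d1 s 1 = F 1 1 ∧ ∀ i < N, ∀ t ∈ Ioo (x i) (x (i + 1)),
        |F 0 t - s t| ≤ 3 * K * H ^ (p + 1) ∧ |F 2 t - d2 s t| ≤ 11 * K * H ^ (p - 1) := by
  have hK0 : 0 ≤ K := (abs_nonneg _).trans (hK 0 (by simp))
  obtain ⟨q, hq⟩ := hx.exists_interpolants hp hF
  obtain ⟨s, hs, s0, s0', s1, s1', hsq⟩ := hx.exists_spline (fun i hi => (hq i hi).1)
    (y := fun i => F 0 (x i)) (z := fun i => F 1 (x i)) (fun i hi =>
      ⟨(hq i hi).2.1, (hq i hi).2.2.1, (hq i hi).2.2.2.1, (hq i hi).2.2.2.2.1⟩)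
  simp only [hx.zero, hx.last] at s0 s0' s1 s1'
  refine ⟨s, hs, s0, s0', s1, s1', fun i hi t ht => ?_⟩
  rw [(hsq i hi t ht).1, (hsq i hi t ht).2]
  obtain ⟨h0, h2⟩ := (hq i hi).2.2.2.2.2 K (fun y hy => hK y
    ⟨(hx.nonneg hi.le).trans hy.1, hy.2.trans (hx.le_one hi)⟩) t (Ioo_subset_Icc_self ht)
  have := sub_nonneg.2 (hx.lt i hi).le
  have hi' := hH i hi
  exact ⟨h0.trans (by gcongr), h2.trans (by gcongr)⟩

/-- Interpolation of a layer function on a mesh that resolves the layer. -/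
lemma IsMesh.exists_spline_resolved (hx : IsMesh N x) (hp : 3 ≤ p) {ε M θ : ℝ} (hε : 0 < ε)
    (hM : 0 ≤ M) (hF : IsLayerTower (p + 1) ε M F) (hθ : ∀ i < N, x (i + 1) - x i ≤ θ * ε) :
    ∃ s : ℝ → ℝ, IsSpline p 1 N x s ∧ s 0 = F 0 0 ∧ d1 s 0 = F 1 0 ∧ s 1 = F 0 1 ∧
      d1 s 1 = F 1 1 ∧ ∀ i < N, ∀ t ∈ Ioo (x i) (x (i + 1)),
        |F 0 t - s t| ≤ 3 * M * Real.exp θ * θ ^ (p + 1) * layer ε t ∧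
        |F 2 t - d2 s t| ≤ 11 * M * Real.exp θ * θ ^ (p - 1) * (ε ^ 2)⁻¹ * layer ε t := by
  obtain ⟨q, hq⟩ := hx.exists_interpolants hp hF.1
  obtain ⟨s, hs, s0, s0', s1, s1', hsq⟩ := hx.exists_spline (fun i hi => (hq i hi).1)
    (y := fun i => F 0 (x i)) (z := fun i => F 1 (x i)) (fun i hi =>
      ⟨(hq i hi).2.1, (hq i hi).2.2.1, (hq i hi).2.2.2.1, (hq i hi).2.2.2.2.1⟩)
  simp only [hx.zero, hx.last] at s0 s0' s1 s1'
  refine ⟨s, hs, s0, s0', s1, s1', fun i hi t ht => ?_⟩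
  rw [(hsq i hi t ht).1, (hsq i hi t ht).2]
  exact interpolant_layer_bound hε hM hF (by omega) (hx.nonneg hi.le) (hx.le_one hi)
    (hθ i hi) (hq i hi).2.2.2.2.2 (Ioo_subset_Icc_self ht)

/-- The correction of an interpolant in the layer region, that allows to continue it by zero. -/
lemma exists_layer_correction {ε M τ a b : ℝ} {n : ℕ} (hε : 0 < ε) (hετ : ε ≤ τ) (hτ : τ ≤ 1 / 2)
    (hM : 0 ≤ M) (hF : IsLayerTower (n + 1) ε M F) (hb : b = τ ∨ b = 1 - τ) (hab : |b - a| = τ) :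
    ∃ c : ℝ[X], c.natDegree ≤ 3 ∧ c.eval a = 0 ∧ c.derivative.eval a = 0 ∧ c.eval b = F 0 b ∧
      c.derivative.eval b = F 1 b ∧ ∀ t ∈ uIcc a b,
        |c.eval t| ≤ 2 * M * Real.exp (-(τ / ε)) * (1 + τ / ε) ∧
        |c.derivative.derivative.eval t| ≤ 20 * M * Real.exp (-(τ / ε)) / (τ * ε) := by
  have hτ0 : 0 < τ := hε.trans_le hετ
  have hne : a ≠ b := by
    rintro rfl
    simp at hab
    linarith
  -- A single cubic spans the whole layer region, so its second derivative involves the width τ and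
  -- not the length of a mesh cell.
  obtain ⟨c, h1, h2, h3, h4, h5, h6⟩ := exists_cubic hne (F 0 b) (F 1 b)
  refine ⟨c, h1, h2, h3, h4, h5, fun t ht => ?_⟩
  have hbI : b ∈ Icc (0 : ℝ) 1 := by
    rcases hb with rfl | rfl <;> constructor <;> linarith
  have hexp : Real.exp (-((1 - τ) / ε)) ≤ Real.exp (-(τ / ε)) := by
    gcongr
    linarith
  have hlay : layer ε b ≤ 2 * Real.exp (-(τ / ε)) := by
    rcases hb with rfl | rfl
    · unfold layer
      linarith
    · unfold layer
      rw [sub_sub_cancel]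
      linarith
  have b0 : |F 0 b| ≤ 2 * M * Real.exp (-(τ / ε)) := by
    calc |F 0 b| ≤ M * (ε ^ 0)⁻¹ * layer ε b := hF.2 0 (by omega) b hbI
      _ = M * layer ε b := by simp
      _ ≤ M * (2 * Real.exp (-(τ / ε))) := by gcongr
      _ = _ := by ring
  have b1 : |F 1 b| ≤ 2 * M * Real.exp (-(τ / ε)) / ε := by
    calc |F 1 b| ≤ M * (ε ^ 1)⁻¹ * layer ε b := hF.2 1 (by omega) b hbI
      _ ≤ M * (ε ^ 1)⁻¹ * (2 * Real.exp (-(τ / ε))) := by gcongr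
      _ = _ := by rw [pow_one]; ring
  obtain ⟨c0, c2⟩ := h6 t ht
  rw [hab] at c0 c2
  constructor
  · calc _ ≤ _ := c0
      _ ≤ 2 * M * Real.exp (-(τ / ε)) + τ * (2 * M * Real.exp (-(τ / ε)) / ε) := by gcongr
      _ = _ := by ring
  · calc _ ≤ _ := c2
      -- One factor 1/τ is relaxed to 1/ε by ε ≤ τ; then 12 + 8 = 20.
      _ ≤ 6 * (2 * M * Real.exp (-(τ / ε))) / (τ * ε) +
          4 * (2 * M * Real.exp (-(τ / ε)) / ε) / τ := by
        gcongr
        rw [pow_two]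
        gcongr
      _ = _ := by
        field_simp
        ring

/-- Approximation of a layer function by a spline that vanishes outside of the layer regions. -/
lemma IsMesh.exists_spline_cutoff (hx : IsMesh N x) (hp : 3 ≤ p) {ε M θ τ : ℝ} {j k : ℕ}
    (hε : 0 < ε) (hετ : ε ≤ τ) (hτ : τ < 1 / 2) (hM : 0 ≤ M) (hF : IsLayerTower (p + 1) ε M F)
    (hjk : j < k) (hkN : k < N) (hxj : x j = τ) (hxk : x k = 1 - τ)
    (hθ : ∀ i < N, i < j ∨ k ≤ i → x (i + 1) - x i ≤ θ * ε) :
    ∃ s : ℝ → ℝ, IsSpline p 1 N x s ∧ s 0 = F 0 0 ∧ d1 s 0 = F 1 0 ∧ s 1 = F 0 1 ∧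
      d1 s 1 = F 1 1 ∧ ∀ i < N, ∀ t ∈ Ioo (x i) (x (i + 1)),
        (t < τ ∨ 1 - τ < t →
          |F 0 t - s t| ≤ 3 * M * Real.exp θ * θ ^ (p + 1) * layer ε t +
            2 * M * Real.exp (-(τ / ε)) * (1 + τ / ε) ∧
          |F 2 t - d2 s t| ≤ 11 * M * Real.exp θ * θ ^ (p - 1) * (ε ^ 2)⁻¹ * layer ε t +
            20 * M * Real.exp (-(τ / ε)) / (τ * ε)) ∧
        (τ < t → t < 1 - τ → s t = 0 ∧ d2 s t = 0) := by
  have hτ0 : 0 < τ := hε.trans_le hετ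
  have hj0 : 0 < j := by
    rcases Nat.eq_zero_or_pos j with rfl | h
    · rw [hx.zero] at hxj
      linarith
    · exact h
  obtain ⟨q, hq⟩ := hx.exists_interpolants hp hF.1
  obtain ⟨c, cd, c0, c0', c1, c1', hc⟩ := exists_layer_correction (a := 0) (b := τ) hε hετ hτ.le hM
    hF (Or.inl rfl) (by rw [sub_zero, abs_of_pos hτ0])
  obtain ⟨e, ed, e0, e0', e1, e1', he⟩ := exists_layer_correction (a := 1) (b := 1 - τ) hε hετ
    hτ.le hM hF (Or.inr rfl) (by rw [sub_sub_cancel_left, abs_neg, abs_of_pos hτ0])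
  -- Subtracting the cubics annihilates the Hermite data at τ and 1 - τ, so the zero pieces in
  -- between fit.
  set Q : ℕ → ℝ[X] := fun i => if i < j then q i - c else if i < k then 0 else q i - e with hQ
  have Q1 : ∀ i, i < j → Q i = q i - c := fun i h => if_pos h
  have Q2 : ∀ i, j ≤ i → i < k → Q i = 0 := fun i h h' => by
    simp only [hQ, if_neg h.not_gt, if_pos h']
  have Q3 : ∀ i, k ≤ i → Q i = q i - e := fun i h => by
    simp only [hQ, if_neg (hjk.le.trans h).not_gt, if_neg h.not_gt]
  -- `Q` is indexed by cells, `y` and `z` by nodes: cell `k` already belongs to the right layer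
  -- region, while node `k` still carries zero data. Hence `i ≤ k` here and `i < k` above.
  set y : ℕ → ℝ := fun i => if i < j then F 0 (x i) - c.eval (x i) else
    if i ≤ k then 0 else F 0 (x i) - e.eval (x i) with hy
  set z : ℕ → ℝ := fun i => if i < j then F 1 (x i) - c.derivative.eval (x i) else
    if i ≤ k then 0 else F 1 (x i) - e.derivative.eval (x i) with hz
  have hdeg : ∀ i < N, (Q i).natDegree ≤ p := by
    intro i hi
    rcases lt_or_ge i j with h | h
    · rw [Q1 i h]
      exact (Polynomial.natDegree_sub_le _ _).trans (max_le (hq i hi).1 (cd.trans hp))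
    · rcases lt_or_ge i k with h' | h'
      · rw [Q2 i h h']
        simp
      · rw [Q3 i h']
        exact (Polynomial.natDegree_sub_le _ _).trans (max_le (hq i hi).1 (ed.trans hp))
  have hdata : ∀ i < N, (Q i).eval (x i) = y i ∧ (Q i).derivative.eval (x i) = z i ∧
      (Q i).eval (x (i + 1)) = y (i + 1) ∧ (Q i).derivative.eval (x (i + 1)) = z (i + 1) := by
    simp only [hy, hz]
    intro i hi
    obtain ⟨-, a1, a2, a3, a4, -⟩ := hq i hi
    rcases lt_or_ge i j with h | h
    · rw [Q1 i h]
      simp only [Polynomial.eval_sub, Polynomial.derivative_sub, a1, a2, a3, a4, if_pos h, true_and]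
      rcases (Nat.succ_le_iff.2 h).eq_or_lt with h' | h'
      · have : i + 1 = j := h'
        simp [this, hxj, c1, c1', hjk.le]
      · have : i + 1 < j := h'
        simp [this]
    · rcases lt_or_ge i k with h' | h'
      · have t1 : ¬ i + 1 < j := by omega
        have t2 : i + 1 ≤ k := h'
        simp [Q2 i h h', h.not_gt, h'.le, t1, t2]
      · have t1 : ¬ i + 1 < j := by omega
        have t2 : ¬ i + 1 ≤ k := by omega
        rw [Q3 i h']
        simp only [Polynomial.eval_sub, Polynomial.derivative_sub, a1, a2, a3, a4, if_neg h.not_gt,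
          if_neg t1, if_neg t2, and_true]
        rcases h'.eq_or_lt with rfl | h''
        · simp [hxk, e1, e1']
        · simp [h''.not_ge]
  obtain ⟨s, hs, s0, s0', s1, s1', hsq⟩ := hx.exists_spline hdeg hdata
  simp only [hy, hz] at s0 s0' s1 s1'
  simp only [hj0, if_true, hx.zero, c0, c0', sub_zero] at s0 s0'
  simp only [(hjk.trans hkN).not_gt, if_false, hkN.not_ge, hx.last, e0, e0', sub_zero] at s1 s1'
  refine ⟨s, hs, s0, s0', s1, s1', fun i hi t ht => ?_⟩
  rw [(hsq i hi t ht).1, (hsq i hi t ht).2]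
  have hLt := (hx.nonneg hi.le).trans ht.1.le
  have hRt := ht.2.le.trans (hx.le_one hi)
  have main := fun h => interpolant_layer_bound (q := q i) hε hM hF (by omega) (hx.nonneg hi.le)
      (hx.le_one hi) (hθ i hi h) (hq i hi).2.2.2.2.2 (Ioo_subset_Icc_self ht)
  have hil : t < τ → i < j := by
    intro h
    by_contra! h'
    have := hx.mono h' hi.le
    linarith [ht.1]
  have hir : 1 - τ < t → k ≤ i := by
    intro h
    by_contra! h'
    have := hx.mono (Nat.succ_le_iff.2 h') hkN.le
    have := ht.2
    simp only [Nat.succ_eq_add_one] at *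
    linarith
  have tri : ∀ a b c : ℝ, |a - (b - c)| ≤ |a - b| + |c| := fun a b c => by
    rw [show a - (b - c) = (a - b) + c by ring]
    exact abs_add_le _ _
  refine ⟨?_, fun h h' => ?_⟩
  · rintro (h | h)
    · obtain ⟨m0, m2⟩ := main (Or.inl (hil h))
      obtain ⟨n0, n2⟩ := hc t (by rw [uIcc_of_le hτ0.le]; exact ⟨hLt, h.le⟩)
      rw [Q1 i (hil h)]
      simp only [Polynomial.eval_sub, Polynomial.derivative_sub]
      exact ⟨(tri _ _ _).trans (add_le_add m0 n0), (tri _ _ _).trans (add_le_add m2 n2)⟩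
    · obtain ⟨m0, m2⟩ := main (Or.inr (hir h))
      obtain ⟨n0, n2⟩ := he t (by rw [uIcc_of_ge (by linarith)]; exact ⟨h.le, hRt⟩)
      rw [Q3 i (hir h)]
      simp only [Polynomial.eval_sub, Polynomial.derivative_sub]
      exact ⟨(tri _ _ _).trans (add_le_add m0 n0), (tri _ _ _).trans (add_le_add m2 n2)⟩
  · have h1 : j ≤ i := by
      by_contra! h1
      have := hx.mono (Nat.succ_le_iff.2 h1) (hjk.trans hkN).le
      have := ht.2
      simp only [Nat.succ_eq_add_one] at *
      linarith
    have h2 : i < k := by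
      by_contra! h2
      have := hx.mono h2 hi.le
      linarith [ht.1]
    simp [Q2 i h1 h2]

end Interpolation

/-! ### Approximation in `L₂` -/

lemma continuous_layer (ε : ℝ) : Continuous (layer ε) := by
  unfold layer
  fun_prop

/-- By (α + β)² ≤ 2α² + 2β² the two layers separate, and the squared exponentials integrate
explicitly. This is where the factor ε is gained. -/
lemma integral_layer_sq_le {ε a b : ℝ} (hε : 0 < ε) (hab : a ≤ b) :
    ∫ x in a..b, layer ε x ^ 2 ≤
      ε * (Real.exp (-(2 * a / ε)) + Real.exp (-(2 * (1 - b) / ε))) := by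
  set g : ℝ → ℝ := fun x => 2 * (Real.exp (-(2 * x / ε)) + Real.exp (-(2 * (1 - x) / ε))) with hg
  have hgc : Continuous g := by
    rw [hg]
    fun_prop
  have h1 : ∫ x in a..b, layer ε x ^ 2 ≤ ∫ x in a..b, g x := by
    refine intervalIntegral.integral_mono_on hab
      (((continuous_layer ε).pow 2).intervalIntegrable _ _) (hgc.intervalIntegrable _ _)
      fun x _ => ?_
    have e1 : Real.exp (-(2 * x / ε)) = Real.exp (-(x / ε)) ^ 2 := by
      rw [← Real.exp_nat_mul]
      congr 1
      push_cast
      ring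
    have e2 : Real.exp (-(2 * (1 - x) / ε)) = Real.exp (-((1 - x) / ε)) ^ 2 := by
      rw [← Real.exp_nat_mul]
      congr 1
      push_cast
      ring
    simp only [hg, e1, e2, layer]
    nlinarith [sq_nonneg (Real.exp (-(x / ε)) - Real.exp (-((1 - x) / ε)))]
  have h2 : ∫ x in a..b, g x = ε * (-Real.exp (-(2 * b / ε)) + Real.exp (-(2 * (1 - b) / ε))) -
      ε * (-Real.exp (-(2 * a / ε)) + Real.exp (-(2 * (1 - a) / ε))) := by
    refine intervalIntegral.integral_eq_sub_of_hasDerivAt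
      (f := fun x => ε * (-Real.exp (-(2 * x / ε)) + Real.exp (-(2 * (1 - x) / ε))))
      (fun x _ => ?_) (hgc.intervalIntegrable _ _)
    have d1 : HasDerivAt (fun x : ℝ => -(2 * x / ε)) (-(2 * 1 / ε)) x :=
      (((hasDerivAt_id x).const_mul 2).div_const ε).neg
    have d2 : HasDerivAt (fun x : ℝ => -(2 * (1 - x) / ε)) (-(2 * (-1) / ε)) x :=
      ((((hasDerivAt_id x).const_sub 1).const_mul 2).div_const ε).neg
    refine ((d1.exp.neg.add d2.exp).const_mul ε).congr_deriv ?_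
    simp only [hg]
    field_simp
  rw [h2] at h1
  refine h1.trans ?_
  have := mul_pos hε (Real.exp_pos (-(2 * b / ε)))
  have := mul_pos hε (Real.exp_pos (-(2 * (1 - a) / ε)))
  nlinarith

lemma integral_sq_le {e g : ℝ → ℝ} {S : Set ℝ} (hS : S.Countable) {a b : ℝ} (hab : a ≤ b)
    (he : IntervalIntegrable (fun x => e x * e x) volume a b) (hg : Continuous g)
    (h : ∀ x ∈ Ioo a b \ S, e x * e x ≤ g x) : ∫ x in a..b, e x * e x ≤ ∫ x in a..b, g x := by
  refine intervalIntegral.integral_mono_ae_restrict hab he (hg.intervalIntegrable _ _) ?_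
  rw [Filter.EventuallyLE, ae_restrict_iff' measurableSet_Icc]
  filter_upwards [hS.ae_notMem volume, (countable_singleton a).ae_notMem volume,
    (countable_singleton b).ae_notMem volume] with x h1 h2 h3 hx
  exact h x ⟨⟨lt_of_le_of_ne hx.1 (Ne.symm h2), lt_of_le_of_ne hx.2 h3⟩, h1⟩

lemma normSq_le_sq {e : ℝ → ℝ} {S : Set ℝ} (hS : S.Countable) (he : MemLp e 2 domainMeasure)
    {κ : ℝ} (h : ∀ x ∈ Ioo (0 : ℝ) 1 \ S, |e x| ≤ κ) : normSq e ≤ κ ^ 2 := by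
  rw [normSq, scal, integral_domain]
  have hi := integrable_domain_iff.1 (MemLp.integrable_mul' he he)
  refine (integral_sq_le (g := fun _ => κ ^ 2) hS zero_le_one hi continuous_const
    fun x hx => ?_).trans (by simp)
  rw [← abs_mul_abs_self]
  nlinarith [h x hx, abs_nonneg (e x)]

/-- An `L₂` bound from pointwise bounds by layer functions in the layer regions and outside. -/
lemma normSq_le_layer {e : ℝ → ℝ} {S : Set ℝ} (hS : S.Countable) (he : MemLp e 2 domainMeasure)
    {ε τ α β κ : ℝ} (hε : 0 < ε) (hτ0 : 0 ≤ τ) (hτ : τ ≤ 1 / 2) (hα : 0 ≤ α) (hβ : 0 ≤ β)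
    (hout : ∀ x ∈ Ioo (0 : ℝ) 1 \ S, x < τ ∨ 1 - τ < x → e x * e x ≤ α * layer ε x ^ 2 + κ)
    (hmid : ∀ x ∈ Ioo (0 : ℝ) 1 \ S, τ < x → x < 1 - τ → e x * e x ≤ β * layer ε x ^ 2) :
    normSq e ≤ ε * (4 * α + 2 * Real.exp (-(τ / ε)) ^ 2 * β) + 2 * τ * κ := by
  rw [normSq, scal, integral_domain]
  have hi := integrable_domain_iff.1 (MemLp.integrable_mul' he he)
  have hsub : ∀ {a b : ℝ}, 0 ≤ a → a ≤ b → b ≤ 1 →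
      IntervalIntegrable (fun x => e x * e x) volume a b := by
    intro a b h1 h2 h3
    refine hi.mono_set ?_
    rw [uIcc_of_le h2, uIcc_of_le zero_le_one]
    exact Icc_subset_Icc h1 h3
  have i1 := hsub le_rfl hτ0 (by linarith)
  have i2 := hsub hτ0 (by linarith : τ ≤ 1 - τ) (by linarith)
  have i3 := hsub (by linarith) (by linarith : 1 - τ ≤ 1) le_rfl
  rw [← intervalIntegral.integral_add_adjacent_intervals (i1.trans i2) i3,
    ← intervalIntegral.integral_add_adjacent_intervals i1 i2]
  have hc : Continuous fun x => layer ε x ^ 2 := (continuous_layer ε).pow 2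
  have out : ∀ {a b : ℝ}, 0 ≤ a → a ≤ b → b ≤ 1 → b - a = τ →
      (∀ x ∈ Ioo a b, x < τ ∨ 1 - τ < x) →
      ∫ x in a..b, e x * e x ≤ 2 * ε * α + τ * κ := by
    intro a b h1 h2 h3 h4 h5
    refine (integral_sq_le (g := fun x => α * layer ε x ^ 2 + κ) hS h2 (hsub h1 h2 h3) ((hc.const_mul α).add continuous_const)
      fun x hx => hout x ⟨⟨h1.trans_lt hx.1.1, hx.1.2.trans_le h3⟩, hx.2⟩ (h5 x hx.1)).trans ?_
    rw [intervalIntegral.integral_add ((hc.const_mul α).intervalIntegrable _ _)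
      (continuous_const.intervalIntegrable _ _), intervalIntegral.integral_const_mul,
      intervalIntegral.integral_const, h4, smul_eq_mul]
    have hl := integral_layer_sq_le hε h2
    have e1 : Real.exp (-(2 * a / ε)) ≤ 1 := Real.exp_le_one_iff.2 (by
      have : 0 ≤ 2 * a / ε := by positivity
      linarith)
    have e2 : Real.exp (-(2 * (1 - b) / ε)) ≤ 1 := Real.exp_le_one_iff.2 (by
      have : 0 ≤ 2 * (1 - b) / ε := by
        have := sub_nonneg.2 h3
        positivity
      linarith)
    have hl' : ∫ x in a..b, layer ε x ^ 2 ≤ 2 * ε := hl.trans (by nlinarith)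
    have := mul_le_mul_of_nonneg_left hl' hα
    linarith
  have mid : ∫ x in τ..(1 - τ), e x * e x ≤ ε * (2 * Real.exp (-(τ / ε)) ^ 2 * β) := by
    refine (integral_sq_le hS (by linarith) i2 (hc.const_mul β)
      fun x hx => hmid x ⟨⟨hτ0.trans_lt hx.1.1, by linarith [hx.1.2]⟩, hx.2⟩ hx.1.1 hx.1.2).trans ?_
    rw [intervalIntegral.integral_const_mul]
    have hl := integral_layer_sq_le hε (by linarith : τ ≤ 1 - τ)
    rw [sub_sub_cancel] at hl
    have e1 : Real.exp (-(2 * τ / ε)) = Real.exp (-(τ / ε)) ^ 2 := by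
      rw [← Real.exp_nat_mul]
      congr 1
      push_cast
      ring
    rw [e1] at hl
    have := mul_le_mul_of_nonneg_left hl hβ
    linarith
  have o1 := out le_rfl hτ0 (by linarith) (by ring) (fun x hx => Or.inl hx.2)
  have o2 := out (by linarith) (by linarith : 1 - τ ≤ 1) le_rfl (by ring)
    (fun x hx => Or.inr hx.1)
  linarith

/-! ### Approximation rates on the Shishkin mesh -/

lemma IsTower.mem_pieceH2 {n : ℕ} {F : ℕ → ℝ → ℝ} (hF : IsTower n F) (hn : 3 ≤ n) :
    F 0 ∈ pieceH2 ∧ EqOn (d1 (F 0)) (F 1) (Icc 0 1) ∧ EqOn (d2 (F 0)) (F 2) (Ioo 0 1) := by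
  have hc : ContinuousOn (F 2) (Icc 0 1) := fun x hx =>
    (hF 2 (by omega) x hx).continuousWithinAt
  obtain ⟨B, hB⟩ := isCompact_Icc.exists_bound_of_continuousOn hc
  exact pieceH2.of_hasDerivWithinAt (hF 0 (by omega)) (hF 1 (by omega)) hB

/-- The rate `N⁻¹ ln N`. -/
def rate (N : ℕ) : ℝ := (N : ℝ)⁻¹ * Real.log N

lemma inv_le_rate {m : ℕ} (hm : 0 < m) : ((4 * m : ℕ) : ℝ)⁻¹ ≤ rate (4 * m) := by
  have := one_le_log hm
  have h0 : 0 ≤ ((4 * m : ℕ) : ℝ)⁻¹ := by positivity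
  unfold rate
  nlinarith

lemma rate_le_one {m : ℕ} (hm : 0 < m) : rate (4 * m) ≤ 1 := by
  have h0 : 0 < ((4 * m : ℕ) : ℝ) := by positivity
  unfold rate
  rw [inv_mul_le_iff₀ h0, mul_one]
  exact (Real.log_le_sub_one_of_pos h0).trans (by linarith)

lemma rate_pos {m : ℕ} (hm : 0 < m) : 0 < rate (4 * m) :=
  lt_of_lt_of_le (by positivity) (inv_le_rate hm)

/-- Approximation of functions with bounded derivatives on the Shishkin mesh. -/
lemma exists_spline_smooth {p : ℕ} (hp : 3 ≤ p) {σ : ℝ} (hσ : 0 < σ) :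
    ∃ C : ℝ, 0 < C ∧ ∀ {ε : ℝ}, 0 < ε → ∀ {m : ℕ}, 0 < m → ∀ {M : ℝ}, 0 ≤ M →
      ∀ {F : ℕ → ℝ → ℝ}, IsTower (p + 1) F → (∀ t ∈ Icc (0 : ℝ) 1, |F (p + 1) t| ≤ M) →
      ∃ s : ℝ → ℝ, IsSpline p 1 (4 * m) (node σ ε (4 * m)) s ∧ s 0 = F 0 0 ∧ d1 s 0 = F 1 0 ∧
        s 1 = F 0 1 ∧ d1 s 1 = F 1 1 ∧
        normSq (F 0 - s) ≤ (C * M * rate (4 * m) ^ (p - 1)) ^ 2 ∧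
        normSq (d2 (F 0) - d2 s) ≤ (C * M * rate (4 * m) ^ (p - 1)) ^ 2 := by
  refine ⟨11 * 2 ^ (p + 1), by positivity, fun {ε} hε {m} hm {M} hM {F} hF hK => ?_⟩
  have hx := isMesh_node hσ hε hm
  obtain ⟨s, hs, s0, s0', s1, s1', hb⟩ := hx.exists_spline_smooth hp hF hK
    (fun i _ => node_succ_sub_le hσ hε hm i)
  refine ⟨s, hs, s0, s0', s1, s1', ?_⟩
  obtain ⟨hF0, hF1, hF2⟩ := hF.mem_pieceH2 (by omega)
  have hsm := hs.mem_pieceH2 hx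
  have hr0 := (rate_pos hm).le
  have hr1 := rate_le_one hm
  have hir := inv_le_rate hm
  have b0 : 3 * M * (2 * ((4 * m : ℕ) : ℝ)⁻¹) ^ (p + 1) ≤
      11 * 2 ^ (p + 1) * M * rate (4 * m) ^ (p - 1) := by
    calc 3 * M * (2 * ((4 * m : ℕ) : ℝ)⁻¹) ^ (p + 1) ≤ 11 * M * (2 * rate (4 * m)) ^ (p + 1) := by
          gcongr
          norm_num
      _ = 11 * 2 ^ (p + 1) * M * rate (4 * m) ^ (p + 1) := by ring
      _ ≤ _ := by
          gcongr 11 * 2 ^ (p + 1) * M * ?_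
          exact pow_le_pow_of_le_one hr0 hr1 (by omega)
  have b2 : 11 * M * (2 * ((4 * m : ℕ) : ℝ)⁻¹) ^ (p - 1) ≤
      11 * 2 ^ (p + 1) * M * rate (4 * m) ^ (p - 1) := by
    calc 11 * M * (2 * ((4 * m : ℕ) : ℝ)⁻¹) ^ (p - 1) ≤ 11 * M * (2 * rate (4 * m)) ^ (p - 1) := by
          gcongr
      _ = 11 * 2 ^ (p - 1) * M * rate (4 * m) ^ (p - 1) := by ring
      _ ≤ _ := by
          gcongr
          · norm_num
          · omega
  constructor
  · refine normSq_le_sq (countable_range (node σ ε (4 * m)))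
      ((pieceH2.memLp hF0).sub (pieceH2.memLp hsm)) fun t ht => ?_
    obtain ⟨i, hi, hti⟩ := hx.exists_mem_Ioo ht
    exact (hb i hi t hti).1.trans b0
  · refine normSq_le_sq (countable_range (node σ ε (4 * m)))
      ((pieceH2.memLp_d2 hF0).sub (pieceH2.memLp_d2 hsm)) fun t ht => ?_
    obtain ⟨i, hi, hti⟩ := hx.exists_mem_Ioo ht
    rw [Pi.sub_apply, hF2 ht.1]
    exact (hb i hi t hti).2.trans b2

lemma mul_self_le_of_abs_le_add {a b c : ℝ} (h : |a| ≤ b + c) :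
    a * a ≤ 2 * b ^ 2 + 2 * c ^ 2 := by
  rw [← abs_mul_abs_self]
  nlinarith [abs_nonneg a, sq_nonneg (b - c)]

set_option maxHeartbeats 1000000 in
/-- Approximation of layer functions on the Shishkin mesh. -/
lemma exists_spline_layer {p : ℕ} (hp : 3 ≤ p) {σ : ℝ} (hσ : (p : ℝ) - 1 ≤ σ) :
    ∃ C : ℝ, 0 < C ∧ ∀ {ε : ℝ}, 0 < ε → ∀ {m : ℕ}, 0 < m → ∀ {M : ℝ}, 0 ≤ M →
      ∀ {F : ℕ → ℝ → ℝ}, IsLayerTower (p + 1) ε M F →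
      ∃ s : ℝ → ℝ, IsSpline p 1 (4 * m) (node σ ε (4 * m)) s ∧ s 0 = F 0 0 ∧ d1 s 0 = F 1 0 ∧
        s 1 = F 0 1 ∧ d1 s 1 = F 1 1 ∧
        normSq (F 0 - s) ≤ (C * M * rate (4 * m) ^ (p - 1)) ^ 2 * ε ∧
        normSq (d2 (F 0) - d2 s) ≤ (C * M * rate (4 * m) ^ (p - 1)) ^ 2 * (ε ^ 3)⁻¹ := by
  have hp' : (3 : ℝ) ≤ p := by exact_mod_cast hp
  have hσ2 : 2 ≤ σ := by linarith
  -- `A` covers both interpolation constants for the relative cell length θ = 4σδ with δ ≤ 1.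
  set A : ℝ := 11 * Real.exp (4 * σ) * (4 * σ) ^ (p + 1) with hA
  have hA0 : 0 ≤ A := by positivity
  -- Here 8A² stems from interpolation, 64σ³ from the cubic, 1600 from its second derivative, and 2
  -- from the region where the spline is zero.
  have hD : 0 < 8 * A ^ 2 + 64 * σ ^ 3 + 1602 := by positivity
  refine ⟨√(8 * A ^ 2 + 64 * σ ^ 3 + 1602), Real.sqrt_pos.2 hD,
    fun {ε} hε {m} hm {M} hM {F} hF => ?_⟩
  have hσ0 : 0 < σ := by linarith
  have hx := isMesh_node hσ0 hε hm
  have hr0 := (rate_pos hm).le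
  have hr1 := rate_le_one hm
  have hL := one_le_log hm
  set τ := transition σ ε (4 * m) with hτ
  set δ := rate (4 * m) with hδ
  set L := Real.log ((4 * m : ℕ) : ℝ) with hLdef
  have hτ0 : 0 < τ := transition_pos hσ0 hε hm
  have hτ4 : τ ≤ 1 / 4 := transition_le σ ε _
  have hm' : (0 : ℝ) < m := by exact_mod_cast hm
  have hτL : τ ≤ σ * ε * L := min_le_right _ _
  -- With m = N/4 and τ ≤ σεL this is 4σεL/N, where L/N = δ.
  have hfine : τ / m ≤ 4 * σ * δ * ε := by
    rw [hδ, rate, ← hLdef, div_le_iff₀ hm']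
    push_cast
    calc τ ≤ σ * ε * L := hτL
      _ = _ := by field_simp
  obtain ⟨hF0, hF1, hF2⟩ := hF.1.mem_pieceH2 (by omega)
  have hθ : 4 * σ * δ ≤ 4 * σ := mul_le_of_le_one_right (by linarith) hr1
  have hexp : Real.exp (4 * σ * δ) ≤ Real.exp (4 * σ) := Real.exp_le_exp.2 hθ
  set a := A * M * δ ^ (p - 1) with ha
  have ha0 : 0 ≤ a := by positivity
  have b0 : 3 * M * Real.exp (4 * σ * δ) * (4 * σ * δ) ^ (p + 1) ≤ a := by
    calc _ ≤ 11 * M * Real.exp (4 * σ) * ((4 * σ) ^ (p + 1) * δ ^ (p - 1)) := by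
          rw [mul_pow]
          have : δ ^ (p + 1) ≤ δ ^ (p - 1) := pow_le_pow_of_le_one hr0 hr1 (by omega)
          gcongr
          norm_num
      _ = a := by
          rw [ha, hA]
          ring
  have b2 : 11 * M * Real.exp (4 * σ * δ) * (4 * σ * δ) ^ (p - 1) ≤ a := by
    calc _ ≤ 11 * M * Real.exp (4 * σ) * ((4 * σ) ^ (p + 1) * δ ^ (p - 1)) := by
          rw [mul_pow]
          have : (4 * σ) ^ (p - 1) ≤ (4 * σ) ^ (p + 1) :=
            pow_le_pow_right₀ (by linarith) (by omega)
          gcongr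
      _ = a := by
          rw [ha, hA]
          ring
  have hC : (√(8 * A ^ 2 + 64 * σ ^ 3 + 1602) * M * δ ^ (p - 1)) ^ 2 =
      8 * a ^ 2 + (64 * σ ^ 3 + 1602) * (M * δ ^ (p - 1)) ^ 2 := by
    rw [mul_assoc, mul_pow, Real.sq_sqrt hD.le, ha]
    ring
  rw [hC]
  have hcount := countable_range (node σ ε (4 * m))
  have hlay := layer_pos ε
  -- In the first case the mesh is uniform and 1/N ≤ 4σεL/N, so every cell is short compared with ε.
  rcases le_or_gt (1 / 4) (σ * ε * L) with hcase | hcase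
  · have hτe : τ = 1 / 4 := min_eq_left hcase
    have hstep : ∀ i < 4 * m, node σ ε (4 * m) (i + 1) - node σ ε (4 * m) i ≤ 4 * σ * δ * ε := by
      intro i _
      refine le_trans (le_of_eq ?_) hfine
      rcases lt_or_ge i m with h | h
      · rw [node_succ_left h, add_sub_cancel_left]
      · rcases lt_or_ge i (3 * m) with h' | h'
        · rw [node_succ_mid hm h h', add_sub_cancel_left, ← hτ, hτe]
          field_simp
          norm_num
        · rw [node_succ_right hm h', add_sub_cancel_left]
    obtain ⟨s, hs, s0, s0', s1, s1', hb⟩ := hx.exists_spline_resolved hp hε hM hF hstep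
    have hsm := hs.mem_pieceH2 hx
    refine ⟨s, hs, s0, s0', s1, s1', ?_, ?_⟩
    · have key : ∀ t ∈ Ioo (0 : ℝ) 1 \ range (node σ ε (4 * m)),
          (F 0 - s) t * (F 0 - s) t ≤ a ^ 2 * layer ε t ^ 2 := by
        intro t ht
        obtain ⟨i, hi, hti⟩ := hx.exists_mem_Ioo ht
        have h := (hb i hi t hti).1.trans (mul_le_mul_of_nonneg_right b0 (hlay t).le)
        rw [← abs_mul_abs_self, ← mul_pow, pow_two]
        exact mul_self_le_mul_self (abs_nonneg _) h
      -- With τ = 0 the middle region is all of (0,1); this gives 6a²ε, within 8a²ε.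
      have h := normSq_le_layer hcount ((pieceH2.memLp hF0).sub (pieceH2.memLp hsm)) hε
        (τ := 0) (α := a ^ 2) (β := a ^ 2) (κ := 0) le_rfl (by norm_num) (sq_nonneg _)
        (sq_nonneg _) (fun t ht _ => by simpa using key t ht) (fun t ht _ _ => key t ht)
      simp only [zero_div, neg_zero, Real.exp_zero, one_pow] at h
      refine h.trans ?_
      have : 0 ≤ (64 * σ ^ 3 + 1602) * (M * δ ^ (p - 1)) ^ 2 * ε := by positivity
      have : 0 ≤ a ^ 2 * ε := by positivity
      linarith
    · have key : ∀ t ∈ Ioo (0 : ℝ) 1 \ range (node σ ε (4 * m)),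
          (d2 (F 0) - d2 s) t * (d2 (F 0) - d2 s) t ≤ (a * (ε ^ 2)⁻¹) ^ 2 * layer ε t ^ 2 := by
        intro t ht
        obtain ⟨i, hi, hti⟩ := hx.exists_mem_Ioo ht
        have h := (hb i hi t hti).2.trans (mul_le_mul_of_nonneg_right
          (mul_le_mul_of_nonneg_right b2 (by positivity)) (hlay t).le)
        rw [← abs_mul_abs_self, ← mul_pow, pow_two, Pi.sub_apply, hF2 ht.1]
        exact mul_self_le_mul_self (abs_nonneg _) h
      have h := normSq_le_layer hcount ((pieceH2.memLp_d2 hF0).sub (pieceH2.memLp_d2 hsm)) hε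
        (τ := 0) (α := (a * (ε ^ 2)⁻¹) ^ 2) (β := (a * (ε ^ 2)⁻¹) ^ 2) (κ := 0) le_rfl
        (by norm_num) (sq_nonneg _)
        (sq_nonneg _) (fun t ht _ => by simpa using key t ht) (fun t ht _ _ => key t ht)
      simp only [zero_div, neg_zero, Real.exp_zero, one_pow] at h
      have e : ε * (4 * (a * (ε ^ 2)⁻¹) ^ 2 + 2 * 1 * (a * (ε ^ 2)⁻¹) ^ 2) + 2 * 0 * 0 =
          6 * a ^ 2 * (ε ^ 3)⁻¹ := by
        field_simp
        ring
      rw [e] at h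
      refine h.trans ?_
      have : 0 ≤ (64 * σ ^ 3 + 1602) * (M * δ ^ (p - 1)) ^ 2 * (ε ^ 3)⁻¹ := by positivity
      have : 0 ≤ a ^ 2 * (ε ^ 3)⁻¹ := by positivity
      linarith
  · have hτe : τ = σ * ε * L := min_eq_right hcase.le
    have hτε : τ / ε = σ * L := by
      rw [hτe]
      field_simp
    have hσL : 2 ≤ σ * L := hσ2.trans (le_mul_of_one_le_right hσ0.le hL)
    have hετ : ε ≤ τ := by
      rw [hτe]
      linarith [mul_le_mul_of_nonneg_left hσL hε.le]
    have hstep : ∀ i < 4 * m, i < m ∨ 3 * m ≤ i →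
        node σ ε (4 * m) (i + 1) - node σ ε (4 * m) i ≤ 4 * σ * δ * ε := by
      rintro i _ (h | h)
      · rw [node_succ_left h, add_sub_cancel_left]
        exact hfine
      · rw [node_succ_right hm h, add_sub_cancel_left]
        exact hfine
    obtain ⟨s, hs, s0, s0', s1, s1', hb⟩ := hx.exists_spline_cutoff hp hε hετ (by linarith) hM hF
      (j := m) (k := 3 * m) (by omega) (by omega) (node_transition_left hm)
      (node_transition_right hm) hstep
    have hsm := hs.mem_pieceH2 hx
    set P := Real.exp (-(τ / ε)) with hP
    have hP0 : 0 < P := Real.exp_pos _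
    set Y := M * δ ^ (p - 1) with hY
    have hY0 : 0 ≤ Y := by positivity
    -- Here P = e^{-σL} = N^{-σ} ≤ N^{-(p-1)}: this is where σ ≥ p - 1 enters.
    have hPN : P * L ^ (p - 1) ≤ δ ^ (p - 1) := by
      rw [hδ, rate, mul_pow, ← hLdef]
      gcongr
      rw [← Real.exp_log (show (0 : ℝ) < ((4 * m : ℕ) : ℝ) by positivity), ← hLdef, ← Real.exp_neg,
        ← Real.exp_nat_mul, hP, hτε]
      gcongr
      push_cast [show 1 ≤ p by omega]
      linarith [mul_le_mul_of_nonneg_right hσ (zero_le_one.trans hL)]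
    have hPL : P * L ^ 2 ≤ δ ^ (p - 1) := by
      refine le_trans ?_ hPN
      gcongr P * ?_
      exact pow_le_pow_right₀ hL (by omega)
    have hMP : M * P * L ^ 2 ≤ Y := by
      calc M * P * L ^ 2 = M * (P * L ^ 2) := by ring
        _ ≤ Y := mul_le_mul_of_nonneg_left hPL hM
    have hMP0 : 0 ≤ M * P := by positivity
    have hMP1 : M * P ≤ Y := by
      exact le_trans (le_mul_of_one_le_right hMP0 (one_le_pow₀ hL)) hMP
    -- The squared cubic brings L², the length τ of the layer region one more L. Since p - 1 ≥ 2,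
    -- the rate affords L⁴.
    have hMP3 : (M * P) ^ 2 * L ^ 3 ≤ Y ^ 2 := by
      calc (M * P) ^ 2 * L ^ 3 ≤ (M * P) ^ 2 * L ^ 4 := by
            gcongr ?_ * ?_
            exact pow_le_pow_right₀ hL (by norm_num)
        _ = (M * P * L ^ 2) ^ 2 := by ring
        _ ≤ Y ^ 2 := by gcongr
    have hMP2 : (M * P) ^ 2 ≤ Y ^ 2 := by gcongr
    refine ⟨s, hs, s0, s0', s1, s1', ?_, ?_⟩
    · have hout : ∀ t ∈ Ioo (0 : ℝ) 1 \ range (node σ ε (4 * m)), t < τ ∨ 1 - τ < t →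
          (F 0 - s) t * (F 0 - s) t ≤
            (2 * a ^ 2) * layer ε t ^ 2 + 2 * (4 * (M * P) * (σ * L)) ^ 2 := by
        intro t ht h
        obtain ⟨i, hi, hti⟩ := hx.exists_mem_Ioo ht
        have h1 := ((hb i hi t hti).1 h).1
        have h2 : |(F 0 - s) t| ≤ a * layer ε t + 4 * (M * P) * (σ * L) := by
          refine h1.trans (add_le_add (mul_le_mul_of_nonneg_right b0 (hlay t).le) ?_)
          rw [hτε]
          -- From σL ≥ 2 the factor 1 + σL is at most 2σL.
          linarith [mul_le_mul_of_nonneg_left hσL hMP0]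
        have h3 := mul_self_le_of_abs_le_add h2
        linarith
      have hmid : ∀ t ∈ Ioo (0 : ℝ) 1 \ range (node σ ε (4 * m)), τ < t → t < 1 - τ →
          (F 0 - s) t * (F 0 - s) t ≤ M ^ 2 * layer ε t ^ 2 := by
        intro t ht h h'
        obtain ⟨i, hi, hti⟩ := hx.exists_mem_Ioo ht
        rw [Pi.sub_apply, ((hb i hi t hti).2 h h').1, sub_zero, ← abs_mul_abs_self, ← mul_pow,
          pow_two]
        refine mul_self_le_mul_self (abs_nonneg _) ?_
        simpa using hF.2 0 (by omega) t (Ioo_subset_Icc_self ht.1)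
      have h := normSq_le_layer hcount ((pieceH2.memLp hF0).sub (pieceH2.memLp hsm)) hε
        hτ0.le (by linarith) (by positivity) (by positivity) hout hmid
      refine h.trans ?_
      have e : ε * (4 * (2 * a ^ 2) + 2 * P ^ 2 * M ^ 2) + 2 * τ * (2 * (4 * (M * P) * (σ * L)) ^ 2)
          = (8 * a ^ 2 + 2 * (M * P) ^ 2 + 64 * σ ^ 3 * ((M * P) ^ 2 * L ^ 3)) * ε := by
        rw [hτe]
        ring
      rw [← hP, e]
      refine mul_le_mul_of_nonneg_right ?_ hε.le
      have h64 : 64 * σ ^ 3 * ((M * P) ^ 2 * L ^ 3) ≤ 64 * σ ^ 3 * Y ^ 2 := by gcongr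
      linarith [sq_nonneg Y]
    · have hout : ∀ t ∈ Ioo (0 : ℝ) 1 \ range (node σ ε (4 * m)), t < τ ∨ 1 - τ < t →
          (d2 (F 0) - d2 s) t * (d2 (F 0) - d2 s) t ≤
            (2 * (a * (ε ^ 2)⁻¹) ^ 2) * layer ε t ^ 2 + 2 * (20 * (M * P) / (τ * ε)) ^ 2 := by
        intro t ht h
        obtain ⟨i, hi, hti⟩ := hx.exists_mem_Ioo ht
        have h1 := ((hb i hi t hti).1 h).2
        have h2 : |(d2 (F 0) - d2 s) t| ≤ a * (ε ^ 2)⁻¹ * layer ε t + 20 * (M * P) / (τ * ε) := by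
          rw [Pi.sub_apply, hF2 ht.1]
          refine h1.trans (add_le_add (mul_le_mul_of_nonneg_right
            (mul_le_mul_of_nonneg_right b2 (by positivity)) (hlay t).le) (le_of_eq ?_))
          ring
        have h3 := mul_self_le_of_abs_le_add h2
        linarith
      have hmid : ∀ t ∈ Ioo (0 : ℝ) 1 \ range (node σ ε (4 * m)), τ < t → t < 1 - τ →
          (d2 (F 0) - d2 s) t * (d2 (F 0) - d2 s) t ≤ (M * (ε ^ 2)⁻¹) ^ 2 * layer ε t ^ 2 := by
        intro t ht h h'
        obtain ⟨i, hi, hti⟩ := hx.exists_mem_Ioo ht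
        rw [Pi.sub_apply, ((hb i hi t hti).2 h h').2, sub_zero, ← abs_mul_abs_self, ← mul_pow,
          pow_two, hF2 ht.1]
        exact mul_self_le_mul_self (abs_nonneg _) (hF.2 2 (by omega) t (Ioo_subset_Icc_self ht.1))
      have h := normSq_le_layer hcount ((pieceH2.memLp_d2 hF0).sub (pieceH2.memLp_d2 hsm)) hε
        hτ0.le (by linarith) (by positivity) (by positivity) hout hmid
      refine h.trans ?_
      rw [← hP]
      -- Integration over length τ cancels one of the two factors 1/τ; the other is at most 1/ε,
      -- again by ε ≤ τ.
      have i1 : 2 * τ * (2 * (20 * (M * P) / (τ * ε)) ^ 2) ≤ 1600 * (M * P) ^ 2 * (ε ^ 3)⁻¹ := by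
        have e : 2 * τ * (2 * (20 * (M * P) / (τ * ε)) ^ 2) =
            1600 * (M * P) ^ 2 * (τ * ε ^ 2)⁻¹ := by
          field_simp
          ring
        rw [e, pow_succ' ε 2]
        gcongr
      have e : ε * (4 * (2 * (a * (ε ^ 2)⁻¹) ^ 2) + 2 * P ^ 2 * (M * (ε ^ 2)⁻¹) ^ 2) =
          (8 * a ^ 2 + 2 * (M * P) ^ 2) * (ε ^ 3)⁻¹ := by
        field_simp
        ring
      rw [e]
      have i2 : (8 * a ^ 2 + 2 * (M * P) ^ 2 + 1600 * (M * P) ^ 2) * (ε ^ 3)⁻¹ ≤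
          (8 * a ^ 2 + (64 * σ ^ 3 + 1602) * Y ^ 2) * (ε ^ 3)⁻¹ := by
        refine mul_le_mul_of_nonneg_right ?_ (by positivity)
        have : 0 ≤ σ ^ 3 * Y ^ 2 := by positivity
        linarith
      linarith

/-! ### The finite element space -/

section FEM

variable {p N : ℕ} {x : ℕ → ℝ} {s t : ℝ → ℝ}

lemma IsSpline.contDiffOn (hs : IsSpline p 1 N x s) : ContDiffOn ℝ 1 s (Icc 0 1) := by
  simpa using hs.1

lemma IsSpline.add (hs : IsSpline p 1 N x s) (ht : IsSpline p 1 N x t) :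
    IsSpline p 1 N x (s + t) := by
  refine ⟨hs.1.add ht.1, fun i hi => ?_⟩
  obtain ⟨q, hq, hq'⟩ := hs.2 i hi
  obtain ⟨r, hr, hr'⟩ := ht.2 i hi
  refine ⟨q + r, (Polynomial.natDegree_add_le _ _).trans (max_le hq hr), fun y hy => ?_⟩
  rw [Pi.add_apply, hq' y hy, hr' y hy, Polynomial.eval_add]

lemma IsSpline.smul (c : ℝ) (hs : IsSpline p 1 N x s) : IsSpline p 1 N x (c • s) := by
  refine ⟨hs.1.const_smul c, fun i hi => ?_⟩
  obtain ⟨q, hq, hq'⟩ := hs.2 i hi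
  refine ⟨c • q, (Polynomial.natDegree_smul_le _ _).trans hq, fun y hy => ?_⟩
  rw [Pi.smul_apply, hq' y hy, Polynomial.eval_smul]

lemma eqOn_of_ae_eq {f g : ℝ → ℝ} (hf : ContinuousOn f (Icc 0 1)) (hg : ContinuousOn g (Icc 0 1))
    (h : f =ᵐ[domainMeasure] g) : EqOn f g (Icc 0 1) := by
  refine Measure.eqOn_Icc_of_ae_eq volume zero_ne_one ?_ hf hg
  rwa [← Measure.restrict_congr_set (Ioo_ae_eq_Icc (μ := volume))]

lemma ae_eq_of_eqOn {f g : ℝ → ℝ} (h : EqOn f g (Icc 0 1)) : f =ᵐ[domainMeasure] g :=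
  ae_domain_of_forall fun _ hx => h (Ioo_subset_Icc_self hx)

lemma d1_congr {f g : ℝ → ℝ} (h : EqOn f g (Icc 0 1)) {y : ℝ} (hy : y ∈ Icc (0 : ℝ) 1) :
    d1 f y = d1 g y :=
  derivWithin_congr h (h hy)

lemma IsSpline.congr (hx : IsMesh N x) (hs : IsSpline p 1 N x s) (h : EqOn t s (Icc 0 1)) :
    IsSpline p 1 N x t := by
  refine ⟨hs.1.congr h, fun i hi => ?_⟩
  obtain ⟨q, hq, hq'⟩ := hs.2 i hi
  exact ⟨q, hq, fun y hy => (h (Ioo_subset_Icc_self (hx.Ioo_subset hi hy))).trans (hq' y hy)⟩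

/-- A spline that vanishes at `p + 1` points of each mesh interval is zero. -/
lemma IsSpline.eq_zero (hx : IsMesh N x) (hs : IsSpline p 1 N x s)
    (h : ∀ i < N, ∀ j : Fin (p + 1),
      s (x i + ((j : ℝ) + 1) / (p + 2) * (x (i + 1) - x i)) = 0) : EqOn s 0 (Icc 0 1) := by
  refine eqOn_of_ae_eq hs.contDiffOn.continuousOn continuousOn_const
    (ae_domain_of_countable (countable_range x) fun y hy => ?_)
  obtain ⟨i, hi, hyi⟩ := hx.exists_mem_Ioo hy
  obtain ⟨q, hq, hq'⟩ := hs.2 i hi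
  have hlt := sub_pos.2 (hx.lt i hi)
  have hp : (0 : ℝ) < p + 2 := by positivity
  -- The p + 1 sample points lie strictly inside the cell, because the spline is known to equal `q`
  -- only on the open interval.
  have h0 : q = 0 := by
    refine Polynomial.eq_zero_of_natDegree_lt_card_of_eval_eq_zero q
      (f := fun j : Fin (p + 1) => x i + ((j : ℝ) + 1) / (p + 2) * (x (i + 1) - x i)) ?_ ?_
      (by simpa using Nat.lt_succ_of_le hq)
    · intro j k hjk
      have := mul_right_cancel₀ hlt.ne' (add_left_cancel hjk)
      rw [div_left_inj' hp.ne', add_left_inj] at this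
      exact Fin.ext (by exact_mod_cast this)
    · intro j
      rw [← hq', h i hi j]
      have hj : ((j : ℕ) : ℝ) + 1 < p + 2 := by
        have : ((j : ℕ) : ℝ) < ((p + 1 : ℕ) : ℝ) := by exact_mod_cast j.2
        push_cast at this
        linarith
      have h1 : ((j : ℝ) + 1) / (p + 2) < 1 := (div_lt_one hp).2 hj
      have h2 : 0 < ((j : ℝ) + 1) / (p + 2) := by positivity
      constructor <;> nlinarith
  rw [hq' y hyi, h0, Polynomial.eval_zero, Pi.zero_apply]

/-- The pairs of splines the first of which satisfies the clamped boundary conditions. -/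
def femSpace (p N : ℕ) (x : ℕ → ℝ) : Submodule ℝ (pieceH2 × pieceH2) where
  carrier := {w | IsSpline p 1 N x w.1 ∧ IsSpline p 1 N x w.2 ∧ (w.1 : ℝ → ℝ) 0 = 0 ∧
    (w.1 : ℝ → ℝ) 1 = 0 ∧ d1 w.1 0 = 0 ∧ d1 w.1 1 = 0}
  add_mem' := by
    rintro w z ⟨h1, h2, h3, h4, h5, h6⟩ ⟨k1, k2, k3, k4, k5, k6⟩
    refine ⟨h1.add k1, h2.add k2, ?_, ?_, ?_, ?_⟩
    · simp [h3, k3]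
    · simp [h4, k4]
    · exact (d1_add w.1.2.1 z.1.2.1 (by simp)).trans (by rw [h5, k5, add_zero])
    · exact (d1_add w.1.2.1 z.1.2.1 (by simp)).trans (by rw [h6, k6, add_zero])
  zero_mem' := by
    have hs : IsSpline p 1 N x 0 := ⟨contDiffOn_const, fun i _ => ⟨0, by simp, by simp⟩⟩
    have hd : d1 (0 : ℝ → ℝ) = 0 := derivWithin_const (Icc (0 : ℝ) 1) (0 : ℝ)
    exact ⟨hs, hs, rfl, rfl, congrFun hd 0, congrFun hd 1⟩
  smul_mem' := by
    rintro c w ⟨h1, h2, h3, h4, h5, h6⟩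
    refine ⟨h1.smul c, h2.smul c, ?_, ?_, ?_, ?_⟩
    · simp [h3]
    · simp [h4]
    · exact (d1_smul c w.1.2.1 (by simp)).trans (by rw [h5, mul_zero])
    · exact (d1_smul c w.1.2.1 (by simp)).trans (by rw [h6, mul_zero])

/-- A spline and its C¹ representative are continuous and agree almost everywhere, hence on [0,1];
the clamped conditions pass from one to the other. -/
lemma memVh_iff {σ ε : ℝ} (w : pieceH2 × pieceH2) :
    MemVh p σ ε N w.1 w.2 ↔ w ∈ femSpace p N (node σ ε N) := by
  constructor
  · rintro ⟨h1, h2, ⟨-, g, hg, hug, g0, g1, g0', g1'⟩, -⟩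
    have he := eqOn_of_ae_eq h1.contDiffOn.continuousOn hg.continuousOn hug
    refine ⟨h1, h2, ?_, ?_, ?_, ?_⟩
    · rw [he (by simp), g0]
    · rw [he (by simp), g1]
    · rw [d1_congr he (by simp)]
      exact g0'
    · rw [d1_congr he (by simp)]
      exact g1'
  · rintro ⟨h1, h2, h3, h4, h5, h6⟩
    exact ⟨h1, h2, ⟨pieceH2.memH_two w.1.2, w.1, h1.contDiffOn, Filter.EventuallyEq.rfl, h3, h4, h5,
      h6⟩, pieceH2.memH_two w.2.2⟩

lemma toL2_congr {f g : pieceH2} (h : EqOn (f : ℝ → ℝ) g (Icc 0 1)) :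
    toL2 f = toL2 g ∧ toL2D2 f = toL2D2 g := by
  have hae := ae_eq_of_eqOn h
  exact ⟨MemLp.toLp_congr (pieceH2.memLp f.2) (pieceH2.memLp g.2) hae,
    MemLp.toLp_congr (pieceH2.memLp_d2 f.2) (pieceH2.memLp_d2 g.2)
    ((pieceH2.weakD2_ae_eq f.2 Filter.EventuallyEq.rfl).symm.trans
      (pieceH2.weakD2_ae_eq g.2 hae))⟩

lemma eqOn_zero_of_toL2_eq_zero {g : pieceH2} (h : toL2 g = 0) :
    EqOn (g : ℝ → ℝ) 0 (Icc 0 1) := by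
  refine eqOn_of_ae_eq (pieceH2.continuousOn g.2) continuousOn_const ?_
  have h1 := coeFn_toL2 g
  rw [h] at h1
  exact h1.symm.trans (Lp.coeFn_zero _ _ _)

/-- The elements of the finite element space that vanish outside of `[0,1]`. -/
def femCore (p N : ℕ) (x : ℕ → ℝ) : Submodule ℝ (pieceH2 × pieceH2) where
  carrier := {w | w ∈ femSpace p N x ∧
    ∀ y ∉ Icc (0 : ℝ) 1, (w.1 : ℝ → ℝ) y = 0 ∧ (w.2 : ℝ → ℝ) y = 0}
  add_mem' := by
    rintro w z ⟨hw, hw'⟩ ⟨hz, hz'⟩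
    refine ⟨add_mem hw hz, fun y hy => ?_⟩
    simp [hw' y hy, hz' y hy]
  zero_mem' := ⟨zero_mem _, fun y _ => by simp⟩
  smul_mem' := by
    rintro c w ⟨hw, hw'⟩
    refine ⟨Submodule.smul_mem _ c hw, fun y hy => ?_⟩
    simp [hw' y hy]

lemma femCore_eq_zero {w : pieceH2 × pieceH2} (hw : w ∈ femCore p N x)
    (h1 : EqOn (w.1 : ℝ → ℝ) 0 (Icc 0 1)) (h2 : EqOn (w.2 : ℝ → ℝ) 0 (Icc 0 1)) : w = 0 := by
  refine Prod.ext (Subtype.ext (funext fun y => ?_)) (Subtype.ext (funext fun y => ?_))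
  · by_cases hy : y ∈ Icc (0 : ℝ) 1
    · exact h1 hy
    · exact (hw.2 y hy).1
  · by_cases hy : y ∈ Icc (0 : ℝ) 1
    · exact h2 hy
    · exact (hw.2 y hy).2

/-- Evaluation at points of the mesh intervals. -/
def evalMap (p N : ℕ) (x : ℕ → ℝ) : pieceH2 →ₗ[ℝ] (Fin N × Fin (p + 1) → ℝ) :=
  LinearMap.pi (fun ij => LinearMap.proj
    (x ij.1 + ((ij.2 : ℝ) + 1) / (p + 2) * (x (ij.1 + 1) - x ij.1))) ∘ₗ pieceH2.subtype

/-- Functions live on ℝ and are arbitrary outside [0,1], so `femSpace` itself is not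
finite-dimensional. After normalisation outside, finitely many point values determine an element. -/
lemma finiteDimensional_femCore (hx : IsMesh N x) :
    FiniteDimensional ℝ (femCore p N x) := by
  refine FiniteDimensional.of_injective
    (((evalMap p N x).prodMap (evalMap p N x)) ∘ₗ (femCore p N x).subtype) ?_
  rw [injective_iff_map_eq_zero]
  rintro ⟨w, hw⟩ h
  have h1 : evalMap p N x w.1 = 0 := congrArg Prod.fst h
  have h2 : evalMap p N x w.2 = 0 := congrArg Prod.snd h
  exact Subtype.ext (femCore_eq_zero hw
    (hw.1.1.eq_zero hx fun i hi j => congrFun h1 (⟨i, hi⟩, j))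
    (hw.1.2.1.eq_zero hx fun i hi j => congrFun h2 (⟨i, hi⟩, j)))

lemma IsSpline.exists_core (hx : IsMesh N x) {f : pieceH2} (hf : IsSpline p 1 N x f) :
    ∃ g : pieceH2, EqOn (g : ℝ → ℝ) f (Icc 0 1) ∧ IsSpline p 1 N x g ∧
      ∀ y ∉ Icc (0 : ℝ) 1, (g : ℝ → ℝ) y = 0 := by
  have he : EqOn ((Icc (0 : ℝ) 1).indicator (f : ℝ → ℝ)) f (Icc 0 1) :=
    fun y hy => indicator_of_mem hy _
  have hs := hf.congr hx he
  exact ⟨⟨_, hs.mem_pieceH2 hx⟩, he, hs, fun y hy => indicator_of_notMem hy _⟩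

lemma exists_femCore (hx : IsMesh N x) {w : pieceH2 × pieceH2} (hw : w ∈ femSpace p N x) :
    ∃ z ∈ femCore p N x, EqOn (z.1 : ℝ → ℝ) w.1 (Icc 0 1) ∧
      EqOn (z.2 : ℝ → ℝ) w.2 (Icc 0 1) := by
  obtain ⟨h1, h2, h3, h4, h5, h6⟩ := hw
  obtain ⟨f, ef, sf, zf⟩ := h1.exists_core hx
  obtain ⟨g, eg, sg, zg⟩ := h2.exists_core hx
  refine ⟨(f, g), ⟨⟨sf, sg, ?_, ?_, ?_, ?_⟩, fun y hy => ⟨zf y hy, zg y hy⟩⟩, ef, eg⟩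
  · exact (ef (by simp)).trans h3
  · exact (ef (by simp)).trans h4
  · exact (d1_congr ef (by simp)).trans h5
  · exact (d1_congr ef (by simp)).trans h6

lemma inner_comm_of_mem {w z : pieceH2 × pieceH2} (hw : w ∈ femSpace p N x) :
    ⟪toL2D2 z.2, toL2 w.1⟫_ℝ = ⟪toL2 z.2, toL2D2 w.1⟫_ℝ :=
  inner_toL2D2_comm hw.2.2.1 hw.2.2.2.1 hw.2.2.2.2.1 hw.2.2.2.2.2

/-- Coercivity kills the L₂ classes, continuity then the functions. Uniqueness and the injectivity
needed for existence both rest on this. -/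
lemma eqOn_zero_of_bilinMap_self {lam e : ℝ} (hlam : 3 ≤ lam) (he : 0 ≤ e) (he1 : e ≤ 1)
    {w : pieceH2 × pieceH2} (hw : w ∈ femSpace p N x) (h : bilinMap lam e w w = 0) :
    EqOn (w.1 : ℝ → ℝ) 0 (Icc 0 1) ∧ EqOn (w.2 : ℝ → ℝ) 0 (Icc 0 1) := by
  have h1 := balancedSq_le_hilbertForm hlam he he1 (inner_comm_of_mem (z := w) hw)
  rw [← bilinMap_eq, h, balancedSq] at h1
  have p2 : 0 ≤ e ^ 6 * ‖toL2D2 w.1‖ ^ 2 := by positivity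
  have p4 : 0 ≤ e ^ 8 * ‖toL2D2 w.2‖ ^ 2 := by positivity
  have n1 : ‖toL2 w.1‖ ^ 2 = 0 := by nlinarith [sq_nonneg ‖toL2 w.1‖, sq_nonneg ‖toL2 w.2‖]
  have n2 : ‖toL2 w.2‖ ^ 2 = 0 := by nlinarith [sq_nonneg ‖toL2 w.1‖, sq_nonneg ‖toL2 w.2‖]
  exact ⟨eqOn_zero_of_toL2_eq_zero (norm_eq_zero.1 (pow_eq_zero_iff two_ne_zero |>.1 n1)),
    eqOn_zero_of_toL2_eq_zero (norm_eq_zero.1 (pow_eq_zero_iff two_ne_zero |>.1 n2))⟩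

/-- Definiteness makes v ↦ B v injective into the dual, which has the same finite dimension. -/
lemma exists_galerkin {V : Type*} [AddCommGroup V] [Module ℝ V] [FiniteDimensional ℝ V]
    (B : V →ₗ[ℝ] V →ₗ[ℝ] ℝ) (hB : ∀ v, B v v = 0 → v = 0) (ℓ : V →ₗ[ℝ] ℝ) :
    ∃ v, B v = ℓ := by
  have hinj : Function.Injective B := by
    rw [injective_iff_map_eq_zero]
    intro v hv
    exact hB v (by rw [hv, LinearMap.zero_apply])
  exact (LinearMap.injective_iff_surjective_of_finrank_eq_finrank
    (Subspace.dual_finrank_eq (K := ℝ) (V := V)).symm).1 hinj ℓ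

lemma isFEMSolution_iff {σ lam e : ℝ} (hx : IsMesh N (node σ (e ^ 2) N)) (he : 0 ≤ e)
    {f : ℝ → ℝ} (hf : MemLp f 2 domainMeasure) (w : pieceH2 × pieceH2) :
    IsFEMSolution p lam σ (e ^ 2) N f w.1 w.2 ↔ w ∈ femSpace p N (node σ (e ^ 2) N) ∧
      ∀ z ∈ femSpace p N (node σ (e ^ 2) N),
        bilinMap lam e w z = ⟪hf.toLp f, residual (e ^ 3) 4 z⟫_ℝ := by
  rw [IsFEMSolution, memVh_iff]
  refine and_congr_right fun _ => ⟨fun h z hz => ?_, fun h us vs hv => ?_⟩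
  · rw [← bilin_eq he, ← functional_eq he hf]
    exact h _ _ ((memVh_iff z).2 hz)
  · have := h (⟨us, hv.1.mem_pieceH2 hx⟩, ⟨vs, hv.2.1.mem_pieceH2 hx⟩) ((memVh_iff _).1 hv)
    rwa [← bilin_eq he, ← functional_eq he hf] at this

lemma exists_femSolution {lam e : ℝ} (hx : IsMesh N x) (hlam : 3 ≤ lam) (he : 0 ≤ e)
    (he1 : e ≤ 1) (G : L2) : ∃ w ∈ femSpace p N x, ∀ z ∈ femSpace p N x,
      bilinMap lam e w z = ⟪G, residual (e ^ 3) 4 z⟫_ℝ := by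
  have := finiteDimensional_femCore (p := p) hx
  set B := (bilinMap lam e).domRestrict₁₂ (femCore p N x) (femCore p N x)
  have hB : ∀ v, B v v = 0 → v = 0 := fun v hv => by
    have h := eqOn_zero_of_bilinMap_self hlam he he1 v.2.1 hv
    exact Subtype.ext (femCore_eq_zero v.2 h.1 h.2)
  obtain ⟨w, hw⟩ := exists_galerkin (V := femCore p N x) B hB
    ((innerₗ L2 G ∘ₗ residual (e ^ 3) 4) ∘ₗ (femCore p N x).subtype)
  refine ⟨w, w.2.1, fun z hz => ?_⟩
  -- The equation sees a test pair only through L₂ classes, so it suffices to test with the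
  -- normalised pair.
  obtain ⟨z', hz', e1, e2⟩ := exists_femCore hx hz
  have h := LinearMap.congr_fun hw ⟨z', hz'⟩
  have h' : bilinMap lam e w z' = ⟪G, residual (e ^ 3) 4 z'⟫_ℝ := h
  rw [bilinMap_eq_inner] at h' ⊢
  simp only [residual_apply, Prod.fst_swap, Prod.snd_swap] at h' ⊢
  rwa [(toL2_congr e1).1, (toL2_congr e1).2, (toL2_congr e2).1, (toL2_congr e2).2] at h'

end FEM

/-! ### The exact solution -/

lemma TimesDifferentiable.isTower {n : ℕ} {g : ℝ → ℝ} (hg : TimesDifferentiable n g) :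
    IsTower n fun k => D k g := by
  intro k hk y hy
  have := (hg k hk y hy).hasDerivWithinAt
  rwa [show derivWithin (D k g) (Icc 0 1) y = D (k + 1) g y by
    simp only [D, iteratedDerivWithin_succ]] at this

/-- Derivatives within [0,1] depend only on values there; this identifies the derivatives of u with
the sums of those of its components. -/
lemma IsTower.eqOn_D {n : ℕ} {F : ℕ → ℝ → ℝ} {g : ℝ → ℝ} (hF : IsTower n F)
    (h : EqOn g (F 0) (Icc 0 1)) : ∀ k ≤ n, EqOn (D k g) (F k) (Icc 0 1) := by
  intro k
  induction k with
  | zero =>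
    intro _ y hy
    simpa [D] using h hy
  | succ k ih =>
    intro hk y hy
    have e : D (k + 1) g y = derivWithin (D k g) (Icc 0 1) y := by
      simp only [D, iteratedDerivWithin_succ]
    have ih' := ih (by omega)
    rw [e, derivWithin_congr ih' (ih' hy)]
    exact (hF k (by omega) y hy).derivWithin (uniqueDiffOn_unit y hy)

lemma IsTower.add {n : ℕ} {F G : ℕ → ℝ → ℝ} (hF : IsTower n F) (hG : IsTower n G) :
    IsTower n fun k => F k + G k :=
  fun k hk y hy => (hF k hk y hy).add (hG k hk y hy)

lemma IsTower.shift {n k : ℕ} {F : ℕ → ℝ → ℝ} (hF : IsTower (n + k) F) :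
    IsTower n fun j => F (j + k) := by
  intro j hj y hy
  have := hF (j + k) (by omega) y hy
  rwa [show j + k + 1 = j + 1 + k by omega] at this

lemma IsTower.mono {n k : ℕ} {F : ℕ → ℝ → ℝ} (hF : IsTower n F) (hk : k ≤ n) : IsTower k F :=
  fun j hj => hF j (by omega)

/-- The second derivative of a layer function is again a layer function with a larger constant, so
one approximation result serves both u and u''. -/
lemma IsLayerTower.shift_two {n : ℕ} {ε M : ℝ} {F : ℕ → ℝ → ℝ} (hF : IsLayerTower (n + 2) ε M F) :
    IsLayerTower n ε (M * (ε ^ 2)⁻¹) fun j => F (j + 2) := by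
  refine ⟨hF.1.shift, fun k hk y hy => (hF.2 (k + 2) (by omega) y hy).trans (le_of_eq ?_)⟩
  rw [pow_add, mul_inv]
  ring

lemma norm_sq_map_add_le {V : Type*} [AddCommGroup V] [Module ℝ V] (T : V →ₗ[ℝ] L2) (f g : V) :
    ‖T (f + g)‖ ^ 2 ≤ 2 * ‖T f‖ ^ 2 + 2 * ‖T g‖ ^ 2 := by
  rw [map_add]
  nlinarith [parallelogram_law_with_norm ℝ (T f) (T g), sq_nonneg ‖T f - T g‖]

lemma normSq_d2_sub (f g : pieceH2) : normSq (d2 f - d2 g) = ‖toL2D2 (f - g)‖ ^ 2 := by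
  rw [← normSq_d2_eq]
  have h : d2 ((f - g : pieceH2) : ℝ → ℝ) =ᵐ[domainMeasure] d2 f - d2 g := by
    filter_upwards [coeFn_toL2D2 (f - g), coeFn_toL2D2 f, coeFn_toL2D2 g,
      Lp.coeFn_sub (toL2D2 f) (toL2D2 g)] with y h1 h2 h3 h4
    rw [← h1, map_sub, h4, Pi.sub_apply, Pi.sub_apply, h2, h3]
  exact (scal_congr h h).symm

set_option maxHeartbeats 1000000 in
/-- Approximation of `(u, ε^{3/2} u'')` for the exact solution `u`, in the balanced norm;
`e = √ε`. -/
lemma exists_approximation {p : ℕ} (hp : 3 ≤ p) {σ : ℝ} (hσ : (p : ℝ) - 1 ≤ σ) :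
    ∃ C : ℝ, 0 < C ∧ ∀ {e : ℝ}, 0 < e → e ≤ 1 → ∀ {m : ℕ}, 0 < m → ∀ {M : ℝ}, 0 ≤ M →
      ∀ {R W : ℕ → ℝ → ℝ}, IsTower (p + 3) R →
      (∀ k ≤ p + 3, ∀ y ∈ Icc (0 : ℝ) 1, |R k y| ≤ M) → IsLayerTower (p + 3) (e ^ 2) M W →
      ∀ U X : pieceH2, (U : ℝ → ℝ) = R 0 + W 0 → (X : ℝ → ℝ) = R 2 + W 2 →
      R 0 0 + W 0 0 = 0 → R 0 1 + W 0 1 = 0 → R 1 0 + W 1 0 = 0 → R 1 1 + W 1 1 = 0 →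
      ∃ w ∈ femSpace p (4 * m) (node σ (e ^ 2) (4 * m)),
        √(balancedSq e (toL2 (U - w.1)) (toL2D2 (U - w.1)) (toL2 (e ^ 3 • X - w.2))
          (toL2D2 (e ^ 3 • X - w.2))) ≤ C * M * rate (4 * m) ^ (p - 1) := by
  have hσ0 : 0 < σ := by
    have : (3 : ℝ) ≤ p := by exact_mod_cast hp
    linarith
  obtain ⟨C₁, hC₁, H₁⟩ := exists_spline_smooth hp hσ0
  obtain ⟨C₂, hC₂, H₂⟩ := exists_spline_layer hp hσ
  refine ⟨4 * (C₁ + C₂), by positivity, fun {e} he he1 {m} hm {M} hM {R W} hR hRb hW U X hU hX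
    u0 u1 u0' u1' => ?_⟩
  have hε : 0 < e ^ 2 := by positivity
  have hx := isMesh_node hσ0 hε hm
  obtain ⟨r, rs, r0, r0', r1, r1', rn, rn2⟩ := H₁ hε hm hM (hR.mono (by omega))
    (hRb (p + 1) (by omega))
  -- The second component is approximated independently of the first. This uses derivatives of u up
  -- to order p + 3; boundary data are not needed.
  obtain ⟨r₂, rs₂, -, -, -, -, rn₂, rn2₂⟩ := H₁ hε hm hM (hR.shift (n := p + 1) (k := 2))
    (hRb (p + 1 + 2) (by omega))
  obtain ⟨w, ws, w0, w0', w1, w1', wn, wn2⟩ := H₂ hε hm hM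
    ⟨hW.1.mono (by omega : p + 1 ≤ p + 3), fun k hk => hW.2 k (by omega)⟩
  have hM2 : 0 ≤ M * ((e ^ 2) ^ 2)⁻¹ := by positivity
  obtain ⟨w₂, ws₂, -, -, -, -, wn₂, wn2₂⟩ := H₂ hε hm hM2 (IsLayerTower.shift_two (n := p + 1) hW)
  simp only [zero_add] at rn₂ rn2₂ wn₂ wn2₂
  have mR : R 0 ∈ pieceH2 := (hR.mem_pieceH2 (by omega)).1
  have mW : W 0 ∈ pieceH2 := (hW.1.mem_pieceH2 (by omega)).1
  have mR₂ : R 2 ∈ pieceH2 := ((hR.shift (n := p + 1) (k := 2)).mem_pieceH2 (by omega)).1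
  have mW₂ : W 2 ∈ pieceH2 := ((hW.1.shift (n := p + 1) (k := 2)).mem_pieceH2 (by omega)).1
  set a := C₁ * M * rate (4 * m) ^ (p - 1) with ha
  set b := C₂ * M * rate (4 * m) ^ (p - 1) with hb
  have hr0 := (rate_pos hm).le
  have ha0 : 0 ≤ a := by positivity
  have hb0 : 0 ≤ b := by positivity
  have eb : C₂ * (M * ((e ^ 2) ^ 2)⁻¹) * rate (4 * m) ^ (p - 1) = b * ((e ^ 2) ^ 2)⁻¹ := by
    rw [hb]
    ring
  rw [eb] at wn₂ wn2₂
  set rI : pieceH2 := ⟨r, rs.mem_pieceH2 hx⟩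
  set wI : pieceH2 := ⟨w, ws.mem_pieceH2 hx⟩
  set rI₂ : pieceH2 := ⟨r₂, rs₂.mem_pieceH2 hx⟩
  set wI₂ : pieceH2 := ⟨w₂, ws₂.mem_pieceH2 hx⟩
  set R0 : pieceH2 := ⟨R 0, mR⟩
  set W0 : pieceH2 := ⟨W 0, mW⟩
  set R2 : pieceH2 := ⟨R 2, mR₂⟩
  set W2 : pieceH2 := ⟨W 2, mW₂⟩
  have q1 : ‖toL2 (R0 - rI)‖ ^ 2 ≤ a ^ 2 := (normSq_eq (R0 - rI)).symm.trans_le rn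
  have q2 : ‖toL2D2 (R0 - rI)‖ ^ 2 ≤ a ^ 2 := (normSq_d2_sub R0 rI).symm.trans_le rn2
  have q3 : ‖toL2 (R2 - rI₂)‖ ^ 2 ≤ a ^ 2 := (normSq_eq (R2 - rI₂)).symm.trans_le rn₂
  have q4 : ‖toL2D2 (R2 - rI₂)‖ ^ 2 ≤ a ^ 2 := (normSq_d2_sub R2 rI₂).symm.trans_le rn2₂
  have q5 : ‖toL2 (W0 - wI)‖ ^ 2 ≤ b ^ 2 * e ^ 2 := (normSq_eq (W0 - wI)).symm.trans_le wn
  have q6 : ‖toL2D2 (W0 - wI)‖ ^ 2 ≤ b ^ 2 * ((e ^ 2) ^ 3)⁻¹ :=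
    (normSq_d2_sub W0 wI).symm.trans_le wn2
  have q7 : ‖toL2 (W2 - wI₂)‖ ^ 2 ≤ (b * ((e ^ 2) ^ 2)⁻¹) ^ 2 * e ^ 2 :=
    (normSq_eq (W2 - wI₂)).symm.trans_le wn₂
  have q8 : ‖toL2D2 (W2 - wI₂)‖ ^ 2 ≤ (b * ((e ^ 2) ^ 2)⁻¹) ^ 2 * ((e ^ 2) ^ 3)⁻¹ :=
    (normSq_d2_sub W2 wI₂).symm.trans_le wn2₂
  have dU : U - (rI + wI) = (R0 - rI) + (W0 - wI) := by
    rw [show U = R0 + W0 from Subtype.ext hU]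
    abel
  have dX : e ^ 3 • X - e ^ 3 • (rI₂ + wI₂) = e ^ 3 • ((R2 - rI₂) + (W2 - wI₂)) := by
    rw [show X = R2 + W2 from Subtype.ext hX]
    module
  refine ⟨(rI + wI, e ^ 3 • (rI₂ + wI₂)), ⟨rs.add ws, (rs₂.add ws₂).smul _, ?_, ?_, ?_, ?_⟩, ?_⟩
  · exact (congrArg₂ (· + ·) r0 w0).trans u0
  · exact (congrArg₂ (· + ·) r1 w1).trans u1
  · exact (d1_add rI.2.1 wI.2.1 (by simp)).trans ((congrArg₂ (· + ·) r0' w0').trans u0')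
  · exact (d1_add rI.2.1 wI.2.1 (by simp)).trans ((congrArg₂ (· + ·) r1' w1').trans u1')
  refine Real.sqrt_le_iff.2 ⟨by positivity, ?_⟩
  simp only [dU, dX]
  have s1 := norm_sq_map_add_le toL2 (R0 - rI) (W0 - wI)
  have s2 := norm_sq_map_add_le toL2D2 (R0 - rI) (W0 - wI)
  have s3 := norm_sq_map_add_le toL2 (R2 - rI₂) (W2 - wI₂)
  have s4 := norm_sq_map_add_le toL2D2 (R2 - rI₂) (W2 - wI₂)
  have e6 : e ^ 6 ≤ 1 := pow_le_one₀ he.le he1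
  have e14 : e ^ 14 ≤ 1 := pow_le_one₀ he.le he1
  have e2 : e ^ 2 ≤ 1 := pow_le_one₀ he.le he1
  -- For the layer parts the powers of `e` are 2 in `t1`, 6 - 6 in `t2`, 6 - 8 + 2 in `t3` and 14 -
  -- 8 - 6 in `t4`; the last three cancel exactly.
  have t1 : ‖toL2 (R0 - rI + (W0 - wI))‖ ^ 2 ≤ 2 * a ^ 2 + 2 * b ^ 2 := by
    linarith [mul_le_of_le_one_right (sq_nonneg b) e2]
  have t2 : e ^ 6 * ‖toL2D2 (R0 - rI + (W0 - wI))‖ ^ 2 ≤ 2 * a ^ 2 + 2 * b ^ 2 := by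
    calc _ ≤ e ^ 6 * (2 * a ^ 2 + 2 * (b ^ 2 * ((e ^ 2) ^ 3)⁻¹)) := by
          gcongr
          linarith
      _ = e ^ 6 * (2 * a ^ 2) + 2 * b ^ 2 := by
          field_simp
      _ ≤ _ := by linarith [mul_le_of_le_one_left (by positivity : 0 ≤ 2 * a ^ 2) e6]
  have t3 : ‖toL2 (e ^ 3 • (R2 - rI₂ + (W2 - wI₂)))‖ ^ 2 ≤ 2 * a ^ 2 + 2 * b ^ 2 := by
    rw [map_smul, norm_smul, mul_pow, Real.norm_eq_abs, sq_abs, ← pow_mul]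
    calc _ ≤ e ^ 6 * (2 * a ^ 2 + 2 * ((b * ((e ^ 2) ^ 2)⁻¹) ^ 2 * e ^ 2)) := by
          gcongr
          linarith
      _ = e ^ 6 * (2 * a ^ 2) + 2 * b ^ 2 := by
          field_simp
      _ ≤ _ := by linarith [mul_le_of_le_one_left (by positivity : 0 ≤ 2 * a ^ 2) e6]
  have t4 : e ^ 8 * ‖toL2D2 (e ^ 3 • (R2 - rI₂ + (W2 - wI₂)))‖ ^ 2 ≤ 2 * a ^ 2 + 2 * b ^ 2 := by
    rw [map_smul, norm_smul, mul_pow, Real.norm_eq_abs, sq_abs, ← pow_mul, ← mul_assoc, ← pow_add]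
    calc _ ≤ e ^ 14 * (2 * a ^ 2 + 2 * ((b * ((e ^ 2) ^ 2)⁻¹) ^ 2 * ((e ^ 2) ^ 3)⁻¹)) := by
          gcongr
          linarith
      _ = e ^ 14 * (2 * a ^ 2) + 2 * b ^ 2 := by
          field_simp
      _ ≤ _ := by linarith [mul_le_of_le_one_left (by positivity : 0 ≤ 2 * a ^ 2) e14]
  have hab : 4 * (C₁ + C₂) * M * rate (4 * m) ^ (p - 1) = 4 * (a + b) := by
    rw [ha, hb]
    ring
  rw [hab, balancedSq]
  -- The four terms add up to at most 8(a² + b²) ≤ 16(a + b)².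
  nlinarith [mul_nonneg ha0 hb0, sq_nonneg a, sq_nonneg b]

lemma balancedNorm_eq (e : ℝ) {u v : ℝ → ℝ} {U V : pieceH2}
    (hu : u =ᵐ[domainMeasure] U) (hv : v =ᵐ[domainMeasure] V) :
    balancedNorm (e ^ 2) u v = √(balancedSq e (toL2 U) (toL2D2 U) (toL2 V) (toL2D2 V)) := by
  have h0 : ∀ {g : ℝ → ℝ} {G : pieceH2}, g =ᵐ[domainMeasure] G → normSq g = ‖toL2 G‖ ^ 2 :=
    fun h => (scal_congr h h).trans (normSq_eq _)
  have h2 : ∀ {g : ℝ → ℝ} {G : pieceH2}, g =ᵐ[domainMeasure] G →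
      normSq (weakD2 g) = ‖toL2D2 G‖ ^ 2 := fun {g G} h =>
    (scal_congr (pieceH2.weakD2_ae_eq G.2 h) (pieceH2.weakD2_ae_eq G.2 h)).trans (normSq_d2_eq _)
  rw [balancedNorm, h0 hu, h2 hu, h0 hv, h2 hv, balancedSq]
  ring_nf

/-- The exact solution satisfies the discrete equations. -/
lemma bilinMap_exact {lam e : ℝ} {U X : pieceH2} (hX : toL2D2 U = toL2 X) {f : ℝ → ℝ}
    (hf : MemLp f 2 domainMeasure) (hode : hf.toLp f = e ^ 8 • toL2D2 X + (4 : ℝ) • toL2 U)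
    (z : pieceH2 × pieceH2) :
    bilinMap lam e (U, e ^ 3 • X) z = ⟪hf.toLp f, residual (e ^ 3) 4 z⟫_ℝ := by
  have h1 : residual (-e ^ 3) 1 (Prod.swap (U, e ^ 3 • X)) = 0 := by
    rw [residual_apply]
    simp only [Prod.swap_prod_mk]
    rw [map_smul, hX]
    module
  have h2 : residual (e ^ 5) 4 (U, e ^ 3 • X) = hf.toLp f := by
    rw [residual_apply, hode, map_smul, smul_smul, ← pow_add]
  rw [bilinMap_eq_inner, h1, h2, inner_zero_left, mul_zero, zero_add]

end ThinShell

end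

/-! ### The error estimate -/

theorem theorem1 (p : ℕ) (hp : 3 ≤ p) (lam : ℝ) (hlam : 3 ≤ lam)
    (σ : ℝ) (hσ : (p : ℝ) - 1 ≤ σ) (M : ℝ) :
    ∃ C : ℝ, 0 < C ∧
      ∀ ε : ℝ, 0 < ε → ε ≤ 1 → ∀ N : ℕ, 0 < N → 4 ∣ N →
      ∀ f u : ℝ → ℝ, ThinShell.IsSolution ε f u →
        (∃ b₀ r b₁ : ℝ → ℝ, ThinShell.IsLayerDecomposition ε M (p + 3) f u b₀ r b₁) →
        (∃ uh vh : ℝ → ℝ, ThinShell.IsFEMSolution p lam σ ε N f uh vh) ∧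
        (∀ uh vh uh' vh' : ℝ → ℝ, ThinShell.IsFEMSolution p lam σ ε N f uh vh →
          ThinShell.IsFEMSolution p lam σ ε N f uh' vh' →
          Set.EqOn uh uh' (Set.Icc 0 1) ∧ Set.EqOn vh vh' (Set.Icc 0 1)) ∧
        (∀ uh vh : ℝ → ℝ, ThinShell.IsFEMSolution p lam σ ε N f uh vh →
          ThinShell.balancedNorm ε (fun x => u x - uh x)
              (fun x => ε ^ (3 / 2 : ℝ) * ThinShell.weakD2 u x - vh x) ≤
            C * ((N : ℝ)⁻¹ * Real.log N) ^ (p - 1)) := by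
  open ThinShell in
  have hp' : (3 : ℝ) ≤ p := by exact_mod_cast hp
  have hσ0 : 0 < σ := by linarith
  obtain ⟨C, hC, happrox⟩ := exists_approximation hp hσ
  have hlam' : 0 < 4 * lam + 26 := by linarith
  -- The constant must be positive for every real M, hence |M| + 1.
  refine ⟨2 * (4 * lam + 26) * (C * (|M| + 1)), by positivity, ?_⟩
  intro ε hε hε1 N hN h4 f u hu ⟨b₀, r, b₁, hdec⟩
  obtain ⟨m, rfl⟩ := h4
  have hm : 0 < m := by omega
  obtain ⟨e, he, rfl⟩ : ∃ e : ℝ, 0 < e ∧ ε = e ^ 2 :=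
    ⟨√ε, Real.sqrt_pos.2 hε, (Real.sq_sqrt hε.le).symm⟩
  have he1 : e ≤ 1 := by
    by_contra! h
    nlinarith
  have hx := isMesh_node hσ0 hε hm
  have hM : 0 ≤ M := (abs_nonneg _).trans (hdec.bound_reg 0 (by omega) 0 (by simp))
  set R : ℕ → ℝ → ℝ := fun k => D k r with hR
  -- Both layers are treated together, measured by `layer`.
  set W : ℕ → ℝ → ℝ := fun k => D k b₀ + D k b₁ with hW
  have tR : IsTower (p + 3) R := hdec.diff_reg.isTower
  have tW : IsLayerTower (p + 3) (e ^ 2) M W := by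
    refine ⟨hdec.diff_left.isTower.add hdec.diff_right.isTower, fun k hk y hy => ?_⟩
    have h1 := hdec.bound_left k hk y hy
    have h2 := hdec.bound_right k hk y hy
    rw [layer, mul_add]
    exact (abs_add_le _ _).trans (add_le_add h1 h2)
  have tT : IsTower (p + 3) fun k => R k + W k := tR.add tW.1
  have huT : Set.EqOn u (R 0 + W 0) (Set.Icc 0 1) := by
    intro y hy
    simp only [hR, hW, D, iteratedDerivWithin_zero, Pi.add_apply]
    rw [hdec.sum y hy]
    ring
  have hD := tT.eqOn_D huT
  obtain ⟨mU, -, dU⟩ := tT.mem_pieceH2 (by omega)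
  obtain ⟨mX, -, dX⟩ := (tT.shift (n := p + 1) (k := 2)).mem_pieceH2 (by omega)
  set U : pieceH2 := ⟨R 0 + W 0, mU⟩
  set X : pieceH2 := ⟨R 2 + W 2, mX⟩
  have huU : u =ᵐ[domainMeasure] U := ae_eq_of_eqOn huT
  have hUX : toL2D2 U = toL2 X :=
    MeasureTheory.MemLp.toLp_congr (pieceH2.memLp_d2 U.2) (pieceH2.memLp X.2)
      (ae_domain_of_forall dU)
  -- Square integrability of f is not assumed; it follows from the differential equation.
  have hfae : f =ᵐ[domainMeasure] (e ^ 8 • toL2D2 X + (4 : ℝ) • toL2 U : L2) := by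
    have hode : ∀ᵐ y ∂domainMeasure, f y = e ^ 8 * d2 X y + 4 * (U : ℝ → ℝ) y := by
      refine ae_domain_of_forall fun y hy => ?_
      have hy' := Set.Ioo_subset_Icc_self hy
      have h4 : D 4 u y = d2 X y := (hD 4 (by omega) hy').trans (dX hy).symm
      rw [← hu.ode y hy, h4, huT hy']
      ring
    filter_upwards [hode, coeFn_toL2D2 X, coeFn_toL2 U,
      MeasureTheory.Lp.coeFn_add (e ^ 8 • toL2D2 X) ((4 : ℝ) • toL2 U),
      MeasureTheory.Lp.coeFn_smul (e ^ 8) (toL2D2 X),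
      MeasureTheory.Lp.coeFn_smul (4 : ℝ) (toL2 U)] with y h1 h2 h3 h4 h5 h6
    rw [h1, h4, Pi.add_apply, h5, h6, Pi.smul_apply, Pi.smul_apply, h2, h3]
    rfl
  have hf : MeasureTheory.MemLp f 2 domainMeasure :=
    (MeasureTheory.memLp_congr_ae hfae).2 (MeasureTheory.Lp.memLp _)
  have hfLp : hf.toLp f = e ^ 8 • toL2D2 X + (4 : ℝ) • toL2 U :=
    MeasureTheory.Lp.ext (hf.coeFn_toLp.trans hfae)
  have hiff := fun w => isFEMSolution_iff (p := p) (lam := lam) hx he.le hf w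
  have hpair : ∀ {uh vh : ℝ → ℝ}, IsFEMSolution p lam σ (e ^ 2) (4 * m) f uh vh →
      ∃ w : pieceH2 × pieceH2, (w.1 : ℝ → ℝ) = uh ∧ (w.2 : ℝ → ℝ) = vh := fun h =>
    ⟨(⟨_, h.1.1.mem_pieceH2 hx⟩, ⟨_, h.1.2.1.mem_pieceH2 hx⟩), rfl, rfl⟩
  refine ⟨?_, ?_, ?_⟩
  · obtain ⟨w, hw, hw'⟩ := exists_femSolution (p := p) hx hlam he.le he1 (hf.toLp f)
    exact ⟨w.1, w.2, (hiff w).2 ⟨hw, hw'⟩⟩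
  · intro uh vh uh' vh' h h'
    obtain ⟨w, rfl, rfl⟩ := hpair h
    obtain ⟨w', rfl, rfl⟩ := hpair h'
    obtain ⟨hw, hw2⟩ := (hiff w).1 h
    obtain ⟨hw', hw2'⟩ := (hiff w').1 h'
    have hd := sub_mem hw hw'
    have h0 : bilinMap lam e (w - w') (w - w') = 0 := by
      rw [LinearMap.map_sub₂, hw2 _ hd, hw2' _ hd, sub_self]
    obtain ⟨z1, z2⟩ := eqOn_zero_of_bilinMap_self hlam he.le he1 hd h0
    exact ⟨fun y hy => sub_eq_zero.1 (z1 hy), fun y hy => sub_eq_zero.1 (z2 hy)⟩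
  · intro uh vh h
    obtain ⟨w, rfl, rfl⟩ := hpair h
    obtain ⟨hw, hw2⟩ := (hiff w).1 h
    have l0 : (0 : ℝ) ∈ Set.Icc (0 : ℝ) 1 := by simp
    have l1 : (1 : ℝ) ∈ Set.Icc (0 : ℝ) 1 := by simp
    have U0 : R 0 0 + W 0 0 = 0 := (huT l0).symm.trans hu.left.1
    have U1 : R 0 1 + W 0 1 = 0 := (huT l1).symm.trans hu.right.1
    have U0' : R 1 0 + W 1 0 = 0 := (hD 1 (by omega) l0).symm.trans hu.left.2
    have U1' : R 1 1 + W 1 1 = 0 := (hD 1 (by omega) l1).symm.trans hu.right.2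
    obtain ⟨wI, hwI, hbound⟩ := happrox he he1 hm hM tR hdec.bound_reg tW U X rfl rfl U0 U1 U0' U1'
    -- Continuity of the form needs the integration by parts for the approximation error of u, which
    -- is clamped as a difference of clamped functions.
    have hUmem : ∀ z : pieceH2 × pieceH2, inner ℝ (toL2D2 z.2) (toL2 (U - wI.1)) =
        inner ℝ (toL2 z.2) (toL2D2 (U - wI.1)) := by
      intro z
      have k1 : inner ℝ (toL2D2 z.2) (toL2 U) = inner ℝ (toL2 z.2) (toL2D2 U) := by
        have hd1 : ∀ y ∈ Set.Icc (0 : ℝ) 1, d1 (R 0 + W 0) y = R 1 y + W 1 y := fun y hy =>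
          (tT 0 (by omega) y hy).derivWithin (uniqueDiffOn_unit y hy)
        exact inner_toL2D2_comm U0 U1 ((hd1 0 l0).trans U0') ((hd1 1 l1).trans U1')
      rw [map_sub, map_sub, inner_sub_right, inner_sub_right, k1, inner_comm_of_mem hwI]
    have hd := sub_mem hw hwI
    -- Galerkin orthogonality: the discrete and the exact pair give the same value against discrete
    -- test pairs.
    have horth : bilinMap lam e (w - wI) (w - wI) =
        bilinMap lam e ((U, e ^ 3 • X) - wI) (w - wI) := by
      rw [LinearMap.map_sub₂, hw2 _ hd, LinearMap.map_sub₂, bilinMap_exact hUX hf hfLp]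
    rw [bilinMap_eq, bilinMap_eq] at horth
    have hcea := sqrt_balancedSq_sub_le hlam he.le he1 (hUmem (w - wI))
      (inner_comm_of_mem (z := w - wI) hd) horth
    have hv : (fun x => (e ^ 2) ^ (3 / 2 : ℝ) * weakD2 u x - (w.2 : ℝ → ℝ) x)
        =ᵐ[domainMeasure] (e ^ 3 • X - w.2 : pieceH2) := by
      filter_upwards [pieceH2.weakD2_ae_eq U.2 huU, ae_domain_of_forall dU] with y h1 h2
      rw [rpow_three_half he.le, h1, h2]
      rfl
    have hu' : (fun x => u x - (w.1 : ℝ → ℝ) x) =ᵐ[domainMeasure] (U - w.1 : pieceH2) := by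
      filter_upwards [huU] with y h1
      rw [h1]
      rfl
    rw [balancedNorm_eq e hu' hv]
    have c1 : ∀ (T : pieceH2 →ₗ[ℝ] L2) (a b c : pieceH2),
        T (a - c) - T (b - c) = T (a - b) := by
      intro T a b c
      rw [← map_sub, sub_sub_sub_cancel_right]
    simp only [Prod.fst_sub, Prod.snd_sub, c1] at hcea
    refine hcea.trans ?_
    rw [mul_assoc (2 * (4 * lam + 26))]
    refine mul_le_mul_of_nonneg_left (hbound.trans ?_) (by positivity)
    have hr : 0 ≤ rate (4 * m) ^ (p - 1) := pow_nonneg (rate_pos hm).le _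
    have hMle : M ≤ |M| + 1 := (le_abs_self M).trans (by linarith)
    exact mul_le_mul_of_nonneg_right (mul_le_mul_of_nonneg_left hMle hC.le) hr
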